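/- Let $G=[g_{ij}]$ be a nonsingular complex $N\times N$ matrix with $G^t=\pm G$, write $G^{-1}=[\overline g_{ij}]$, and let the upper sign refer to the symmetric and the lower sign to the skew-symmetric case. Let $E_{ij}$ be the standard basis of $\mathfrak{gl}_N$, put $F_{ij}=E_{ij}-\sum_{k,l=1}^N g_{ik}\,\overline g_{lj}\,E_{lk}$, and let $\mathfrak g_N\subset\mathfrak{gl}_N$ be the Lie subalgebra spanned by the $F_{ij}$ (so $\mathfrak g_N\cong\mathfrak o_N$ in the symmetric and $\mathfrak g_N\cong\mathfrak{sp}_N$ in the skew-symmetric case). Let $F=[F_{ij}]$, regarded as the $N\times N$ matrix $\sum_{i,j} e_{ij}\otimes F_{ij}\in\operatorname{End}\mathbb C^N\otimes \mathrm U(\mathfrak g_N)$, where $e_{ij}$ are the matrix units. Let $\kappa=N/2\mp1$, $P=\sum_{i,j}e_{ij}\otimes e_{ji}$, $Q=G_1\big(\sum_{i,j}e_{ij}\otimes e_{ij}\big)G_1^{-1}$ with $G_1=G\otimes 1$, and $$R(u)=1-\frac{P}{u}+\frac{Q}{u-\kappa}.$$ The reflection algebra $\mathrm B(\mathfrak g_N)$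 is the unital associative $\mathbb C$-algebra with generators $s_{ij}^{(r)}$, $1\le i,j\le N$, $r\ge1$, and defining relations $$R(u-v)\,S_1(u)\,R(u+v)\,S_2(v)=S_2(v)\,R(u+v)\,S_1(u)\,R(u-v),\qquad S(u)\,S(-u)=1,$$ where $S(u)=\sum_{i,j}e_{ij}\otimes s_{ij}(u)$ with $s_{ij}(u)=\delta_{ij}+\sum_{r\ge1}s_{ij}^{(r)}u^{-r}$, the indices $1,2$ of $S_1=\sum e_{ij}\otimes1\otimes s_{ij}$ and $S_2=\sum 1\otimes e_{ij}\otimes s_{ij}$ indicate the copy of $\operatorname{End}\mathbb C^N$, and the rational functions of $u,v$ are expanded into series in $v^{-1}$, so that the first relation is an identity of formal series with coefficients in the algebra. Then the matrix $u-F+N/4$ is invertible over $\mathrm U(\mathfrak g_N)((u^{-1}))$, and the mapping $$S(u)\mapsto\frac{u+F-N/4}{u-F+N/4}=1+2\sum_{r=1}^{\infty}\Big(F-\frac N4\Big)^{r}u^{-r}$$ defines an algebra homomorphism $\mathrm B(\mathfrak g_N)\to\mathrm U(\mathfrak g_N)$; that is, the displayed equality holds and there is a unique homomorphism of unital $\mathbb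 C$-algebras $\mathrm B(\mathfrak g_N)\to\mathrm U(\mathfrak g_N)$ which, applied to the coefficients of $S(u)$, gives this matrix. -/

import Mathlib

open scoped Matrix Kronecker PowerSeries LaurentSeries

noncomputable section

namespace ReflectionAlgebra

/-! ### The orthogonal and symplectic Lie algebras -/

section LieAlg

attribute [local instance 100] LieRing.ofAssociativeRing

variable {N : ℕ}

/-- `F_ij = E_ij - ∑_{k,l} g_ik ḡ_lj E_lk`, where `G = [g_ij]` and `G⁻¹ = [ḡ_ij]`. -/
def lieF (G : Matrix (Fin N) (Fin N) ℂ) (i j : Fin N) : Matrix (Fin N) (Fin N) ℂ :=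
  Matrix.single i j 1 - ∑ k, ∑ l, (G i k * G⁻¹ l j) • Matrix.single l k (1 : ℂ)

/-- The Lie subalgebra `𝔤_N` of `𝔤𝔩_N` spanned by the elements `F_ij`. It is `𝔬_N` for symmetric
nonsingular `G` and `𝔰𝔭_N` for skew-symmetric nonsingular `G`. -/
def gN (G : Matrix (Fin N) (Fin N) ℂ) : LieSubalgebra ℂ (Matrix (Fin N) (Fin N) ℂ) :=
  LieSubalgebra.lieSpan ℂ _ (Set.range fun p : Fin N × Fin N => lieF G p.1 p.2)

theorem lieF_mem_gN (G : Matrix (Fin N) (Fin N) ℂ) (i j : Fin N) : lieF G i j ∈ gN G :=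
  LieSubalgebra.subset_lieSpan ⟨(i, j), rfl⟩

/-- The universal enveloping algebra `U(𝔤_N)`. -/
abbrev UgN (G : Matrix (Fin N) (Fin N) ℂ) : Type :=
  UniversalEnvelopingAlgebra ℂ (gN G)

/-- The matrix `F = [F_ij]` with entries in `U(𝔤_N)`. -/
def matF (G : Matrix (Fin N) (Fin N) ℂ) : Matrix (Fin N) (Fin N) (UgN G) :=
  Matrix.of fun i j => UniversalEnvelopingAlgebra.ι ℂ (⟨lieF G i j, lieF_mem_gN G i j⟩ : gN G)

theorem lieF_eq (G : Matrix (Fin N) (Fin N) ℂ) (i j : Fin N) :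
    lieF G i j = Matrix.single i j 1 - G⁻¹ * (Matrix.single i j 1)ᵀ * G := by
  unfold lieF
  congr 1
  ext a b
  simp [Matrix.sum_apply, Matrix.mul_apply, Matrix.single_apply, ite_and, mul_comm]

/-- For nonsingular symmetric or skew-symmetric `G`, the Lie algebra `𝔤_N` consists of all matrices
that are skew-adjoint for the bilinear form of `G`. -/
theorem gN_eq_skewAdjoint (G : Matrix (Fin N) (Fin N) ℂ) (hdet : IsUnit G.det) (ε : ℤˣ)
    (hG : Gᵀ = ((ε : ℤ) : ℂ) • G) : gN G = skewAdjointMatricesLieSubalgebra G := by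
  have hu : G⁻¹ * G = 1 := Matrix.nonsing_inv_mul G hdet
  have hu' : G * G⁻¹ = 1 := Matrix.mul_nonsing_inv G hdet
  have hε : ((ε : ℤ) : ℂ) * ((ε : ℤ) : ℂ) = 1 := by
    rcases Int.units_eq_one_or ε with h | h <;> simp [h]
  have hGi : (G⁻¹)ᵀ = ((ε : ℤ) : ℂ) • G⁻¹ := by
    have h1 : (((ε : ℤ) : ℂ) • G⁻¹) * Gᵀ = 1 := by
      rw [hG, Matrix.smul_mul, Matrix.mul_smul, smul_smul, hε, hu, one_smul]
    rw [Matrix.transpose_nonsing_inv]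
    exact Matrix.inv_eq_left_inv h1
  apply le_antisymm
  · refine LieSubalgebra.lieSpan_le.2 ?_
    rintro _ ⟨⟨i, j⟩, rfl⟩
    have key : (lieF G i j)ᵀ * G = G * (-lieF G i j) := by
      rw [lieF_eq]
      simp only [Matrix.transpose_sub, Matrix.transpose_mul, Matrix.transpose_transpose, hG, hGi,
        Matrix.smul_mul, Matrix.mul_smul, smul_smul, hε, one_smul, sub_mul, neg_sub, mul_sub]
      simp only [Matrix.mul_assoc, hu, Matrix.mul_one]
      rw [← Matrix.mul_assoc G G⁻¹, hu', Matrix.one_mul]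
    rw [SetLike.mem_coe, mem_skewAdjointMatricesLieSubalgebra, mem_skewAdjointMatricesSubmodule]
    exact key
  · intro A hA
    have hA' : Aᵀ * G = G * (-A) := by
      rw [mem_skewAdjointMatricesLieSubalgebra, mem_skewAdjointMatricesSubmodule] at hA
      exact hA
    have h2 : G⁻¹ * Aᵀ * G = -A := by
      rw [Matrix.mul_assoc, hA', ← Matrix.mul_assoc, hu, Matrix.one_mul]
    have h3 : ∑ i, ∑ j, A i j • lieF G i j = A - G⁻¹ * Aᵀ * G := by
      conv_rhs => rw [Matrix.matrix_eq_sum_single A]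
      simp only [lieF_eq, smul_sub, Finset.sum_sub_distrib, Matrix.transpose_sum,
        Matrix.mul_sum, Matrix.sum_mul]
      congr 1
      · simp
      · refine Finset.sum_congr rfl fun i _ => Finset.sum_congr rfl fun j _ => ?_
        rw [← Matrix.smul_mul, ← Matrix.mul_smul]
        simp
    have h4 : A = (1 / 2 : ℂ) • ∑ i, ∑ j, A i j • lieF G i j := by
      rw [h3, h2, sub_neg_eq_add, ← two_smul ℂ A, smul_smul]
      norm_num
    rw [h4]
    exact (gN G).smul_mem _ (sum_mem fun i _ => sum_mem fun j _ =>
      (gN G).smul_mem _ (lieF_mem_gN G i j))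

end LieAlg

/-! ### Laurent series in `u⁻¹` and `v⁻¹`

`A⸨X⸩` stands for `A((u⁻¹))`, with `X = u⁻¹`. Identities in `u` and `v` are read in the iterated
ring `A((u⁻¹))((v⁻¹))`, where rational functions such as `(u - v)⁻¹` are expanded into series in
`v⁻¹`. -/

section Series

/-- The map `A((X)) → B((X))` induced on coefficients by a ring homomorphism `A → B`. -/
def mapLaurent {A B : Type*} [Ring A] [Ring B] (f : A →+* B) : A⸨X⸩ →+* B⸨X⸩ where
  toFun x := x.map f
  map_one' := HahnSeries.map_one f.toMonoidWithZeroHom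
  map_mul' _ _ := HahnSeries.map_mul (f : A →ₙ+* B)
  map_zero' := by ext; simp
  map_add' _ _ := HahnSeries.map_add (f : A →+ B)

/-- `A((u⁻¹))((v⁻¹))`. -/
abbrev Laurent₂ (A : Type*) [Ring A] : Type _ := LaurentSeries (LaurentSeries A)

/-- The substitution `f(u) ∈ A[[u⁻¹]] ↦ f(u) ∈ A((u⁻¹))((v⁻¹))`. -/
def inU (A : Type*) [Ring A] : A⟦X⟧ →+* Laurent₂ A :=
  (HahnSeries.C : LaurentSeries A →+* Laurent₂ A).comp (HahnSeries.ofPowerSeries ℤ A)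

/-- The substitution `f(u) ∈ A[[u⁻¹]] ↦ f(v) ∈ A((u⁻¹))((v⁻¹))`. -/
def inV (A : Type*) [Ring A] : A⟦X⟧ →+* Laurent₂ A :=
  (HahnSeries.ofPowerSeries ℤ (LaurentSeries A)).comp
    (PowerSeries.map (HahnSeries.C : A →+* LaurentSeries A))

/-- The variable `u`, as an element of `ℂ((u⁻¹))((v⁻¹))`. -/
def varU : Laurent₂ ℂ := HahnSeries.C (HahnSeries.single (-1) 1)

/-- The variable `v`, as an element of `ℂ((u⁻¹))((v⁻¹))`. -/
def varV : Laurent₂ ℂ := HahnSeries.single (-1) 1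

/-- Complex constants in `ℂ((u⁻¹))((v⁻¹))`. -/
def const₂ : ℂ →+* Laurent₂ ℂ :=
  (HahnSeries.C : LaurentSeries ℂ →+* Laurent₂ ℂ).comp HahnSeries.C

/-- The canonical map `ℂ((u⁻¹))((v⁻¹)) → A((u⁻¹))((v⁻¹))`. -/
def scalars₂ (A : Type*) [Ring A] [Algebra ℂ A] : Laurent₂ ℂ →+* Laurent₂ A :=
  mapLaurent (mapLaurent (algebraMap ℂ A))

/-- The substitution `f(u) ↦ f(-u)` on `A[[u⁻¹]]`. -/
def negArg {A : Type*} [Ring A] (f : A⟦X⟧) : A⟦X⟧ :=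
  PowerSeries.mk fun n => (-1) ^ n * PowerSeries.coeff n f

end Series

/-! ### The `R`-matrix -/

section RMatrix

variable {N : ℕ}

/-- The permutation operator `P = ∑ e_ij ⊗ e_ji`. -/
def opP (N : ℕ) : Matrix (Fin N × Fin N) (Fin N × Fin N) ℂ :=
  ∑ i, ∑ j, Matrix.single i j 1 ⊗ₖ Matrix.single j i 1

/-- The partial transpose `Pᵗ = ∑ e_ij ⊗ e_ij`. -/
def opPt (N : ℕ) : Matrix (Fin N × Fin N) (Fin N × Fin N) ℂ :=
  ∑ i, ∑ j, Matrix.single i j 1 ⊗ₖ Matrix.single i j 1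

/-- `Q = G₁ Pᵗ G₁⁻¹`. -/
def opQ (G : Matrix (Fin N) (Fin N) ℂ) : Matrix (Fin N × Fin N) (Fin N × Fin N) ℂ :=
  (G ⊗ₖ 1) * opPt N * (G⁻¹ ⊗ₖ 1)

/-- `κ = N/2 ∓ 1`, the sign `ε` being `1` in the symmetric and `-1` in the skew-symmetric case. -/
def kappa (N : ℕ) (ε : ℤˣ) : ℂ := (N : ℂ) / 2 - ((ε : ℤ) : ℂ)

/-- `R(z) = 1 - P/z + Q/(z - κ)`, for `z` in the field `ℂ((u⁻¹))((v⁻¹))`. -/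
def opR (G : Matrix (Fin N) (Fin N) ℂ) (ε : ℤˣ) (z : Laurent₂ ℂ) :
    Matrix (Fin N × Fin N) (Fin N × Fin N) (Laurent₂ ℂ) :=
  1 - z⁻¹ • (opP N).map const₂ + (z - const₂ (kappa N ε))⁻¹ • (opQ G).map const₂

end RMatrix

/-! ### The reflection algebra -/

section Reflection

variable {N : ℕ}

/-- The matrix `[δ_ij + ∑_{r ≥ 1} s_ij^(r) u^{-r}]` with entries in `A[[u⁻¹]]`. -/
def genMatrix {A : Type*} [Ring A] (s : Fin N → Fin N → ℕ+ → A) :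
    Matrix (Fin N) (Fin N) A⟦X⟧ :=
  Matrix.of fun i j => PowerSeries.mk fun n =>
    if h : 0 < n then s i j ⟨n, h⟩ else if i = j then 1 else 0

/-- `R(u - v) S₁(u) R(u + v) S₂(v)`, with `S₁ = S ⊗ 1` and `S₂ = 1 ⊗ S`. -/
def reflLHS {A : Type*} [Ring A] [Algebra ℂ A] (G : Matrix (Fin N) (Fin N) ℂ) (ε : ℤˣ)
    (S : Matrix (Fin N) (Fin N) A⟦X⟧) :
    Matrix (Fin N × Fin N) (Fin N × Fin N) (Laurent₂ A) :=
  (opR G ε (varU - varV)).map (scalars₂ A) * (S.map (inU A) ⊗ₖ 1) *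
    (opR G ε (varU + varV)).map (scalars₂ A) * (1 ⊗ₖ S.map (inV A))

/-- `S₂(v) R(u + v) S₁(u) R(u - v)`. -/
def reflRHS {A : Type*} [Ring A] [Algebra ℂ A] (G : Matrix (Fin N) (Fin N) ℂ) (ε : ℤˣ)
    (S : Matrix (Fin N) (Fin N) A⟦X⟧) :
    Matrix (Fin N × Fin N) (Fin N × Fin N) (Laurent₂ A) :=
  (1 ⊗ₖ S.map (inV A)) * (opR G ε (varU + varV)).map (scalars₂ A) *
    (S.map (inU A) ⊗ₖ 1) * (opR G ε (varU - varV)).map (scalars₂ A)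

/-- The free associative algebra on the symbols `s_ij^(r)`, `1 ≤ i, j ≤ N`, `r ≥ 1`. -/
abbrev FreeB (N : ℕ) : Type := FreeAlgebra ℂ (Fin N × Fin N × ℕ+)

/-- The matrix `S(u)` over the free algebra. -/
def freeS (N : ℕ) : Matrix (Fin N) (Fin N) (FreeB N)⟦X⟧ :=
  genMatrix fun i j r => FreeAlgebra.ι ℂ (i, j, r)

/-- The defining relations: all coefficients of all matrix entries of the reflection equation
`R(u - v) S₁(u) R(u + v) S₂(v) = S₂(v) R(u + v) S₁(u) R(u - v)` and of the unitary condition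
`S(u) S(-u) = 1`. -/
inductive Rel (G : Matrix (Fin N) (Fin N) ℂ) (ε : ℤˣ) : FreeB N → FreeB N → Prop
  | reflection (p q : Fin N × Fin N) (m n : ℤ) :
      Rel G ε (((reflLHS G ε (freeS N) p q).coeff m).coeff n)
        (((reflRHS G ε (freeS N) p q).coeff m).coeff n)
  | unitary (i j : Fin N) (n : ℕ) :
      Rel G ε (PowerSeries.coeff n ((freeS N * (freeS N).map negArg) i j))
        (PowerSeries.coeff n ((1 : Matrix (Fin N) (Fin N) (FreeB N)⟦X⟧) i j))

/-- The reflection algebra `B(𝔤_N)`. -/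
abbrev B (G : Matrix (Fin N) (Fin N) ℂ) (ε : ℤˣ) : Type := RingQuot (Rel G ε)

/-- The generator `s_ij^(r)` of `B(𝔤_N)`. -/
def genB (G : Matrix (Fin N) (Fin N) ℂ) (ε : ℤˣ) (i j : Fin N) (r : ℕ+) : B G ε :=
  RingQuot.mkAlgHom ℂ (Rel G ε) (FreeAlgebra.ι ℂ (i, j, r))

/-- The matrix `S(u)` over `B(𝔤_N)[[u⁻¹]]`. -/
def matS (G : Matrix (Fin N) (Fin N) ℂ) (ε : ℤˣ) : Matrix (Fin N) (Fin N) (B G ε)⟦X⟧ :=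
  genMatrix (genB G ε)

end Reflection

/-! ### The evaluation -/

section Evaluation

variable {N : ℕ}

/-- The matrix `F - N/4` over `U(𝔤_N)`. -/
def shiftF (G : Matrix (Fin N) (Fin N) ℂ) : Matrix (Fin N) (Fin N) (UgN G) :=
  matF G - ((N : ℂ) / 4) • (1 : Matrix (Fin N) (Fin N) (UgN G))

/-- The matrix `u + F - N/4` over `U(𝔤_N)((u⁻¹))`. -/
def evalNum (G : Matrix (Fin N) (Fin N) ℂ) : Matrix (Fin N) (Fin N) (UgN G)⸨X⸩ :=
  Matrix.scalar (Fin N) (HahnSeries.single (-1) 1) + (shiftF G).map HahnSeries.C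

/-- The matrix `u - F + N/4` over `U(𝔤_N)((u⁻¹))`. -/
def evalDen (G : Matrix (Fin N) (Fin N) ℂ) : Matrix (Fin N) (Fin N) (UgN G)⸨X⸩ :=
  Matrix.scalar (Fin N) (HahnSeries.single (-1) 1) - (shiftF G).map HahnSeries.C

/-- The matrix `1 + 2 ∑_{r ≥ 1} (F - N/4)^r u^{-r}` over `U(𝔤_N)[[u⁻¹]]`. -/
def evalSeries (G : Matrix (Fin N) (Fin N) ℂ) : Matrix (Fin N) (Fin N) (UgN G)⟦X⟧ :=
  genMatrix fun i j r => 2 * (shiftF G ^ (r : ℕ)) i j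

end Evaluation

end ReflectionAlgebra

end

noncomputable section

/-! Write `M = F - N/4`, let `a = M₁` and `b = M₂` be its two copies, and put `X = (u - a)⁻¹`, `Y =
(v - b)⁻¹`. The quotient `(u + M)/(u - M)` equals `2u(u - M)⁻¹ - 1`, so the reflection equation
becomes an identity between `P`, `Q`, `X` and `Y`, with scalars in the field `ℂ((u⁻¹))((v⁻¹))`. It
is proved in `reflection_of_resolvent` from three kinds of facts: `P² = 1`, `PQ = QP = ±Q`, `Q² =
NQ`; `a` commutes with `b - P + Q`, which is the commutation rule of `𝔤_N` (`shiftF_comm`); `Q(F₁ +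
F₂) = 0 = (F₁ + F₂)Q`, which after the shift reads `Qa = -Qb - (N/2)Q`, and likewise on the other
side.

Since `X` also commutes with `b - P + Q`, multiplying `[X, b]` by `Y` on both sides gives a formula
for `[X, Y]`. Multiplying `[X, b]` by `Q` instead yields `(u + v - κ)QXY` in terms of shorter or
more elementary products; the shift by `N/4` is what makes this constant equal to the `κ` of the
`R`-matrix. With these rules both sides of the reflection equation take a common normal form, and
they differ by a multiple of the formula for `[X, Y]`.

The unitary condition says that `(u + M)/(u - M)` and `(u - M)/(u + M)` are inverse to each other
(`unitary_evalSeries`). The relations of `B(𝔤_N)` are imposed coefficientwise over a free algebra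
and are natural in the coefficient algebra, so a matrix that satisfies them defines a homomorphism
(`exists_algHom_of_relations`). -/

namespace ReflectionAlgebra

/-! ### The reflection equation from resolvents, in an abstract algebra -/

section Abstract

variable {K M : Type*} [Field K] [Ring M] [Algebra K M]

/-- The product of the resolvents `X = (u - a)⁻¹` and `Z = (v - a)⁻¹`. -/
theorem resolvent_mul_resolvent {u v : K} {a X Z : M} (huv : u - v ≠ 0)
    (hX : X * a = u • X - 1) (hZ : a * Z = v • Z - 1) :
    X * Z = (u - v)⁻¹ • (Z - X) := by
  have h : X * a * Z = X * (a * Z) := mul_assoc _ _ _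
  rw [hX, hZ, sub_mul, mul_sub, smul_mul_assoc, mul_smul_comm, one_mul, mul_one] at h
  have h2 : (u - v) • (X * Z) = Z - X := by
    rw [sub_smul]; linear_combination (norm := module) h
  rw [← h2, smul_smul, inv_mul_cancel₀ huv, one_smul]

/-- A matrix `a` whose two copies `a = A₁`, `b = A₂` satisfy the commutation relations of `𝔤_N`
gives a solution `(u + a) (u - a)⁻¹ = 2 u (u - a)⁻¹ - 1` of the reflection equation. -/
theorem reflection_of_resolvent {u v κ ε n : K} {P Q a b X Y : M}
    (hn : n = 2 * κ + 2 * ε)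
    (h₁ : u - v ≠ 0) (h₂ : u + v ≠ 0) (h₃ : u - v - κ ≠ 0) (h₄ : u + v - κ ≠ 0)
    (hPP : P * P = 1) (hPQ : P * Q = ε • Q) (hQP : Q * P = ε • Q) (hQQ : Q * Q = n • Q)
    (hPa : P * a = b * P) (hQa : Q * a = -(Q * b) - (n / 2) • Q)
    (haQ : a * Q = -(b * Q) - (n / 2) • Q)
    (hab : a * b - b * a = a * P - P * a - a * Q + Q * a)
    (hXa : X * a = u • X - 1) (haX : a * X = u • X - 1)
    (hYb : Y * b = v • Y - 1) (hbY : b * Y = v • Y - 1) (h2 : (2 : K) ≠ 0) :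
    (1 - (u - v)⁻¹ • P + (u - v - κ)⁻¹ • Q) * ((2 * u) • X - 1) *
        (1 - (u + v)⁻¹ • P + (u + v - κ)⁻¹ • Q) * ((2 * v) • Y - 1) =
      ((2 * v) • Y - 1) * (1 - (u + v)⁻¹ • P + (u + v - κ)⁻¹ • Q) *
        ((2 * u) • X - 1) * (1 - (u - v)⁻¹ • P + (u - v - κ)⁻¹ • Q) := by
  have hPb : P * b = a * P := by
    calc P * b = P * (b * P) * P := by rw [mul_assoc, mul_assoc, hPP, mul_one]
      _ = a * P := by rw [← hPa, ← mul_assoc, hPP, one_mul]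
  -- Conjugation by `P` exchanges `a` and `b`, so `Xv = (v - a)⁻¹` and `Yu = (u - b)⁻¹`. Resolvents
  -- of the same element multiply by the resolvent identity.
  obtain ⟨Xv, hXv⟩ : ∃ Z, Z = P * Y * P := ⟨_, rfl⟩
  obtain ⟨Yu, hYu⟩ : ∃ Z, Z = P * X * P := ⟨_, rfl⟩
  have hPX : P * X = Yu * P := by rw [hYu, mul_assoc, hPP, mul_one]
  have hXP : X * P = P * Yu := by rw [hYu, ← mul_assoc, ← mul_assoc, hPP, one_mul]
  have hPY : P * Y = Xv * P := by rw [hXv, mul_assoc, hPP, mul_one]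
  have hYub : Yu * b = u • Yu - 1 := by
    rw [hYu, mul_assoc, hPb, mul_assoc, ← mul_assoc X, hXa, sub_mul, mul_sub, one_mul, hPP,
      smul_mul_assoc, mul_smul_comm, mul_assoc]
  have hbYu : b * Yu = u • Yu - 1 := by
    rw [hYu, ← mul_assoc, ← mul_assoc, ← hPa, mul_assoc P, haX, mul_sub, sub_mul, mul_one, hPP,
      mul_smul_comm, smul_mul_assoc]
  have haXv : a * Xv = v • Xv - 1 := by
    rw [hXv, ← mul_assoc, ← mul_assoc, ← hPb, mul_assoc P, hbY, mul_sub, sub_mul, mul_one, hPP,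
      mul_smul_comm, smul_mul_assoc]
  have hXXv := resolvent_mul_resolvent h₁ hXa haXv
  have hYuY := resolvent_mul_resolvent h₁ hYub hbY
  have hYYu : Y * Yu = (u - v)⁻¹ • (Y - Yu) := by
    have := resolvent_mul_resolvent (by rwa [← neg_sub, neg_ne_zero] : v - u ≠ 0) hYb hbYu
    rw [this, ← neg_sub u v, inv_neg]; module
  -- `X` commutes with `b - P + Q`
  have hXb : X * b - b * X = X * P - P * X - X * Q + Q * X := by
    have e : X * (a * b - b * a) * X = X * (a * P - P * a - a * Q + Q * a) * X := by rw [hab]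
    have e1 : X * (a * b - b * a) * X = X * a * (b * X) - X * b * (a * X) := by noncomm_ring
    have e2 : X * (a * P - P * a - a * Q + Q * a) * X
        = X * a * (P * X) - X * P * (a * X) - X * a * (Q * X) + X * Q * (a * X) := by
      noncomm_ring
    rw [e1, e2, hXa, haX] at e
    simp only [sub_mul, mul_sub, smul_mul_assoc, mul_smul_comm, one_mul, mul_one, mul_assoc] at e
    linear_combination (norm := module) e
  -- commutation of `Q` past `X`
  have hQXb : Q * X * b = (κ - u) • (Q * X) + Q + ε • (Q * Yu) - Q * X * Q := by
    have e : Q * (X * b - b * X) = Q * (X * P - P * X - X * Q + Q * X) := by rw [hXb]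
    have e1 : Q * (b * X) = -(u • (Q * X) - Q) - (n / 2) • (Q * X) := by
      have : Q * b = -(Q * a) - (n / 2) • Q := by rw [hQa]; abel
      rw [← mul_assoc, this, sub_mul, neg_mul, mul_assoc, haX, smul_mul_assoc, mul_sub,
        mul_smul_comm, mul_one]
    have e2 : Q * (P * X) = ε • (Q * X) := by rw [← mul_assoc, hQP, smul_mul_assoc]
    have e3 : Q * (Q * X) = n • (Q * X) := by rw [← mul_assoc, hQQ, smul_mul_assoc]
    have e4 : Q * (X * P) = ε • (Q * Yu) := by rw [hXP, ← mul_assoc, hQP, smul_mul_assoc]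
    simp only [mul_sub, mul_add, e1, e2, e3, e4] at e
    -- The coefficient of `Q * X` is `-u - n/2 + n - ε`, and `n/2 - ε = κ`.
    subst hn
    linear_combination (norm := skip) e
    simp only [mul_assoc]
    match_scalars <;> field_simp <;> ring
  have hbXQ : b * (X * Q) = (κ - u) • (X * Q) + Q + ε • (Yu * Q) - Q * X * Q := by
    have e : (X * b - b * X) * Q = (X * P - P * X - X * Q + Q * X) * Q := by rw [hXb]
    have e1 : X * b * Q = -(u • (X * Q) - Q) - (n / 2) • (X * Q) := by
      have : b * Q = -(a * Q) - (n / 2) • Q := by rw [haQ]; abel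
      rw [mul_assoc, this, mul_sub, mul_neg, ← mul_assoc, hXa, mul_smul_comm, sub_mul,
        smul_mul_assoc, one_mul]
    have e2 : X * P * Q = ε • (X * Q) := by rw [mul_assoc, hPQ, mul_smul_comm]
    have e3 : X * Q * Q = n • (X * Q) := by rw [mul_assoc, hQQ, mul_smul_comm]
    have e4 : P * X * Q = ε • (Yu * Q) := by rw [hPX, mul_assoc, hPQ, mul_smul_comm]
    simp only [sub_mul, add_mul, e1, e2, e3, e4] at e
    subst hn
    linear_combination (norm := skip) -e
    simp only [mul_assoc]
    match_scalars <;> field_simp <;> ring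
  -- Multiply `hQXb` by `Y` on the right and use `b * Y = v • Y - 1`: the coefficients `v` and `κ -
  -- u` of `QXY` combine to `u + v - κ`.
  have hQXY : Q * (X * Y) = (u + v - κ)⁻¹ •
      (Q * X + Q * Y + ε • (Q * (Yu * Y)) - Q * (X * (Q * Y))) := by
    have e : Q * X * b * Y = Q * X * (b * Y) := mul_assoc _ _ _
    rw [hQXb, hbY] at e
    simp only [sub_mul, add_mul, mul_sub, smul_mul_assoc, mul_smul_comm, mul_one, mul_assoc] at e
    rw [eq_inv_smul_iff₀ h₄]
    linear_combination (norm := module) -e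
  have hYXQ : Y * (X * Q) = (u + v - κ)⁻¹ •
      (X * Q + Y * Q + ε • (Y * (Yu * Q)) - Y * (Q * (X * Q))) := by
    have e : Y * (b * (X * Q)) = Y * b * (X * Q) := (mul_assoc _ _ _).symm
    rw [hbXQ, hYb] at e
    simp only [sub_mul, mul_add, mul_sub, smul_mul_assoc, mul_smul_comm, one_mul, mul_assoc] at e
    rw [eq_inv_smul_iff₀ h₄]
    linear_combination (norm := module) -e
  -- the commutator of `X` and `Y`
  have hXY : X * Y = Y * X + (u - v)⁻¹ • (Yu * (Xv * P) - Y * (X * P))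
      + (u + v - κ)⁻¹ • (Y * (Q * X) - X * (Q * Y))
      + (ε * (u + v - κ)⁻¹ * (u - v)⁻¹) • (Yu * (Q * Y) - Y * (Q * Yu)) := by
    -- The left side collapses to `XY - YX`, because `bY = vY - 1` and `Yb = vY - 1`. On the right,
    -- the two occurrences of `YQXQY` cancel.
    have e : Y * (X * b - b * X) * Y = Y * (X * P - P * X - X * Q + Q * X) * Y := by rw [hXb]
    have e1 : Y * (X * b - b * X) * Y = Y * X * (b * Y) - Y * b * (X * Y) := by noncomm_ring
    have e2 : Y * (X * P - P * X - X * Q + Q * X) * Y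
        = Y * (X * (P * Y)) - Y * (P * X) * Y - Y * (X * Q) * Y + Y * (Q * (X * Y)) := by
      noncomm_ring
    have e3 : Y * (X * (P * Y)) = (u - v)⁻¹ • (Y * (Xv * P) - Y * (X * P)) := by
      rw [hPY, ← mul_assoc X, hXXv, smul_mul_assoc, mul_smul_comm, sub_mul, mul_sub]
    have e4 : Y * (P * X) * Y = (u - v)⁻¹ • (Y * (Xv * P) - Yu * (Xv * P)) := by
      rw [hPX, ← mul_assoc, hYYu, smul_mul_assoc, smul_mul_assoc, sub_mul, sub_mul, mul_assoc,
        mul_assoc, hPY]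
    rw [e1, e2, e3, e4, hYXQ, hQXY, hYb, hbY] at e
    have e5 : Y * (Yu * (Q * Y)) = (u - v)⁻¹ • (Y * (Q * Y) - Yu * (Q * Y)) := by
      rw [← mul_assoc, hYYu, smul_mul_assoc, sub_mul]
    rw [hYuY] at e
    simp only [sub_mul, mul_add, add_mul, mul_sub, smul_mul_assoc, mul_smul_comm, one_mul, mul_one,
      mul_assoc, e5] at e
    linear_combination (norm := module) e
  have tail : ∀ {p q r : M}, p * q = r → ∀ z, p * (q * z) = r * z := by
    rintro p q _ rfl z; rw [mul_assoc]
  have hQXP : Q * (X * P) = ε • (Q * Yu) := by rw [hXP, ← mul_assoc, hQP, smul_mul_assoc]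
  simp only [mul_sub, sub_mul, mul_add, add_mul, smul_mul_assoc, mul_smul_comm, mul_one, one_mul,
    mul_assoc, smul_sub, smul_add, smul_smul, hPX, hPY, hPP, hPQ, hQP, hQQ, tail hXXv,
    hYuY, tail hYYu, hQXY, hYXQ, hQXP]
  subst hn
  -- The term `QXQY` from `R(u + v)` cancels against the one in `hQXY`, so no value of `QXQ` is
  -- needed. What is left is `hXY`, scaled by the product of the factors `2u` and `2v`.
  linear_combination (norm := skip) (4 * u * v) • hXY
  simp only [smul_sub, smul_add, smul_smul]
  match_scalars <;> field_simp <;> ring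

/-- `reflection_of_resolvent`, for scalars that act through a ring homomorphism into the centre. The
homomorphism is unbundled, so that it need not refer to the field structure of `K`. -/
theorem reflection_of_central {K M : Type*} [Field K] [Ring M] (f : K → M)
    (hf₁ : f 1 = 1) (hf_add : ∀ k l, f (k + l) = f k + f l) (hf_mul : ∀ k l, f (k * l) = f k * f l)
    (hf : ∀ k m, f k * m = m * f k) {u v κ ε n : K} {P Q a b X Y : M}
    (hn : n = 2 * κ + 2 * ε)
    (h₁ : u - v ≠ 0) (h₂ : u + v ≠ 0) (h₃ : u - v - κ ≠ 0) (h₄ : u + v - κ ≠ 0)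
    (hPP : P * P = 1) (hPQ : P * Q = f ε * Q) (hQP : Q * P = f ε * Q) (hQQ : Q * Q = f n * Q)
    (hPa : P * a = b * P) (hQa : Q * a = -(Q * b) - f (n / 2) * Q)
    (haQ : a * Q = -(b * Q) - f (n / 2) * Q)
    (hab : a * b - b * a = a * P - P * a - a * Q + Q * a)
    (hXa : X * a = f u * X - 1) (haX : a * X = f u * X - 1)
    (hYb : Y * b = f v * Y - 1) (hbY : b * Y = f v * Y - 1) (h2 : (2 : K) ≠ 0) :
    (1 - f (u - v)⁻¹ * P + f (u - v - κ)⁻¹ * Q) * (f (2 * u) * X - 1) *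
        (1 - f (u + v)⁻¹ * P + f (u + v - κ)⁻¹ * Q) * (f (2 * v) * Y - 1) =
      (f (2 * v) * Y - 1) * (1 - f (u + v)⁻¹ * P + f (u + v - κ)⁻¹ * Q) *
        (f (2 * u) * X - 1) * (1 - f (u - v)⁻¹ * P + f (u - v - κ)⁻¹ * Q) :=
  letI : Algebra K M := RingHom.toAlgebra'
    { toFun := f
      map_one' := hf₁
      map_mul' := hf_mul
      map_zero' := by simpa using hf_add 0 0
      map_add' := hf_add } hf
  reflection_of_resolvent hn h₁ h₂ h₃ h₄ hPP hPQ hQP hQQ hPa hQa haQ hab hXa haX hYb hbY h2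

end Abstract

/-! ### The operators `P` and `Q` -/

section Operators

variable {N : ℕ}

theorem opP_apply (i k j l : Fin N) :
    opP N (i, k) (j, l) = if i = l ∧ k = j then 1 else 0 := by
  simp only [opP, Matrix.sum_apply, Matrix.kroneckerMap_apply, Matrix.single_apply, ite_and,
    mul_ite, mul_one, mul_zero]
  simp [Finset.sum_ite_eq, eq_comm]

theorem opPt_apply (i k j l : Fin N) :
    opPt N (i, k) (j, l) = if i = k ∧ j = l then 1 else 0 := by
  simp only [opPt, Matrix.sum_apply, Matrix.kroneckerMap_apply, Matrix.single_apply, ite_and,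
    mul_ite, mul_one, mul_zero]
  simp [Finset.sum_ite_eq, eq_comm]

theorem opQ_apply (G : Matrix (Fin N) (Fin N) ℂ) (i k j l : Fin N) :
    opQ G (i, k) (j, l) = G i k * G⁻¹ l j := by
  simp [opQ, Matrix.mul_apply, Fintype.sum_prod_type, opPt_apply, Matrix.one_apply, ite_and]

theorem opP_mul_opP : opP N * opP N = 1 := by
  ext ⟨i, k⟩ ⟨j, l⟩
  simp [Matrix.mul_apply, Fintype.sum_prod_type, opP_apply, Matrix.one_apply, ite_and,
    eq_comm]

variable {G : Matrix (Fin N) (Fin N) ℂ} {ε : ℤˣ}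

theorem sign_mul_self (ε : ℤˣ) : ((ε : ℤ) : ℂ) * ((ε : ℤ) : ℂ) = 1 := by
  rcases Int.units_eq_one_or ε with h | h <;> simp [h]

theorem apply_symm (hG : Gᵀ = ((ε : ℤ) : ℂ) • G) (i j : Fin N) :
    G i j = ((ε : ℤ) : ℂ) * G j i := by
  simpa using congrFun (congrFun hG j) i

theorem inv_apply_symm (hdet : IsUnit G.det) (hG : Gᵀ = ((ε : ℤ) : ℂ) • G) (i j : Fin N) :
    G⁻¹ i j = ((ε : ℤ) : ℂ) * G⁻¹ j i := by
  have h : (((ε : ℤ) : ℂ) • G⁻¹) * Gᵀ = 1 := by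
    rw [hG, Matrix.smul_mul, Matrix.mul_smul, smul_smul, sign_mul_self,
      Matrix.nonsing_inv_mul G hdet, one_smul]
  have h' : (G⁻¹)ᵀ = ((ε : ℤ) : ℂ) • G⁻¹ := by
    rw [Matrix.transpose_nonsing_inv]
    exact Matrix.inv_eq_left_inv h
  simpa using congrFun (congrFun h' j) i

/-- `Q` has the rank-one form `g_ik ḡ_lj`, and left multiplication by `P` swaps the indices of `G`;
right multiplication swaps those of `G⁻¹`. -/
theorem opP_mul_opQ (hG : Gᵀ = ((ε : ℤ) : ℂ) • G) :
    opP N * opQ G = ((ε : ℤ) : ℂ) • opQ G := by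
  ext ⟨i, k⟩ ⟨j, l⟩
  simp [Matrix.mul_apply, Fintype.sum_prod_type, opP_apply, opQ_apply, ite_and]
  rw [apply_symm hG k i]; ring

theorem opQ_mul_opP (hdet : IsUnit G.det) (hG : Gᵀ = ((ε : ℤ) : ℂ) • G) :
    opQ G * opP N = ((ε : ℤ) : ℂ) • opQ G := by
  ext ⟨i, k⟩ ⟨j, l⟩
  simp [Matrix.mul_apply, Fintype.sum_prod_type, opP_apply, opQ_apply, ite_and]
  rw [inv_apply_symm hdet hG j l]; ring

theorem opQ_mul_opQ (hdet : IsUnit G.det) : opQ G * opQ G = (N : ℂ) • opQ G := by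
  have h : opPt N * opPt N = (N : ℂ) • opPt N := by
    ext ⟨i, k⟩ ⟨j, l⟩
    simp [Matrix.mul_apply, Fintype.sum_prod_type, opPt_apply, ite_and]
    split_ifs <;> rfl
  have h1 : (G⁻¹ ⊗ₖ (1 : Matrix (Fin N) (Fin N) ℂ)) * (G ⊗ₖ 1) = 1 := by
    rw [← Matrix.mul_kronecker_mul, Matrix.nonsing_inv_mul G hdet, one_mul, Matrix.one_kronecker_one]
  calc opQ G * opQ G
      = (G ⊗ₖ 1) * (opPt N * ((G⁻¹ ⊗ₖ 1) * (G ⊗ₖ 1)) * opPt N) * (G⁻¹ ⊗ₖ 1) := by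
        simp only [opQ, Matrix.mul_assoc]
    _ = (N : ℂ) • opQ G := by rw [h1, mul_one, h, Matrix.mul_smul, Matrix.smul_mul]; rfl

end Operators

/-! ### Commutation relations of the matrix `F` -/

section Commutation

attribute [local instance 100] LieRing.ofAssociativeRing

variable {N : ℕ} {G : Matrix (Fin N) (Fin N) ℂ} {ε : ℤˣ}

/-- The linear map `M ↦ M - G⁻¹ Mᵀ G` from `𝔤𝔩_N` onto `𝔤_N`; it maps `E_ij` to `F_ij`. -/
def skewProj (G : Matrix (Fin N) (Fin N) ℂ) :
    Matrix (Fin N) (Fin N) ℂ →ₗ[ℂ] Matrix (Fin N) (Fin N) ℂ where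
  toFun M := M - G⁻¹ * Mᵀ * G
  map_add' A B := by
    rw [Matrix.transpose_add, mul_add, add_mul]; abel
  map_smul' c A := by
    rw [Matrix.transpose_smul, Matrix.mul_smul, Matrix.smul_mul, smul_sub]; rfl

theorem skewProj_apply (M : Matrix (Fin N) (Fin N) ℂ) : skewProj G M = M - G⁻¹ * Mᵀ * G := rfl

theorem skewProj_single (i j : Fin N) : skewProj G (Matrix.single i j 1) = lieF G i j :=
  (lieF_eq G i j).symm

/-- Transposing `G` and `G⁻¹` produces one sign each, and the signs cancel. Together with
`twist_mul`, this makes `θ(M) = G⁻¹ Mᵀ G` an involutive anti-automorphism. -/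
theorem twist_twist (hdet : IsUnit G.det) (hG : Gᵀ = ((ε : ℤ) : ℂ) • G)
    (M : Matrix (Fin N) (Fin N) ℂ) : G⁻¹ * (G⁻¹ * Mᵀ * G)ᵀ * G = M := by
  have hGi : (G⁻¹)ᵀ = ((ε : ℤ) : ℂ) • G⁻¹ := by
    ext i j
    simpa using inv_apply_symm hdet hG j i
  have h : G⁻¹ * (G * (M * (G⁻¹ * G))) = M := by
    rw [← mul_assoc, Matrix.nonsing_inv_mul G hdet, one_mul, mul_one]
  simp only [Matrix.transpose_mul, Matrix.transpose_transpose, hG, hGi, Matrix.mul_smul,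
    Matrix.smul_mul, smul_smul, sign_mul_self, one_smul, mul_assoc, h]

theorem skewProj_twist (hdet : IsUnit G.det) (hG : Gᵀ = ((ε : ℤ) : ℂ) • G)
    (M : Matrix (Fin N) (Fin N) ℂ) : skewProj G (G⁻¹ * Mᵀ * G) = -skewProj G M := by
  rw [skewProj_apply, skewProj_apply, twist_twist hdet hG, neg_sub]

theorem twist_mul (hdet : IsUnit G.det) (A B : Matrix (Fin N) (Fin N) ℂ) :
    G⁻¹ * (A * B)ᵀ * G = (G⁻¹ * Bᵀ * G) * (G⁻¹ * Aᵀ * G) := by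
  have h : G * (G⁻¹ * (Aᵀ * G)) = Aᵀ * G := by
    rw [← mul_assoc, Matrix.mul_nonsing_inv G hdet, one_mul]
  rw [Matrix.transpose_mul]
  simp only [mul_assoc, h]

/-- With `π = 1 - θ`, the element `B' = π(B)` satisfies `θ(B') = -B'`. Hence `θ[A, B'] = [θA, B']`,
and bracketing with `B'` commutes with `π`. -/
theorem skewProj_bracket (hdet : IsUnit G.det) (hG : Gᵀ = ((ε : ℤ) : ℂ) • G)
    (A B : Matrix (Fin N) (Fin N) ℂ) :
    ⁅skewProj G A, skewProj G B⁆ = skewProj G (A * skewProj G B - skewProj G B * A) := by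
  obtain ⟨θ, hθ⟩ : ∃ θ : Matrix (Fin N) (Fin N) ℂ → Matrix (Fin N) (Fin N) ℂ,
    ∀ M, G⁻¹ * Mᵀ * G = θ M := ⟨_, fun _ => rfl⟩
  have hmul : ∀ A B, θ (A * B) = θ B * θ A := fun A B => by
    simp only [← hθ, twist_mul hdet]
  have hsub : ∀ A B, θ (A - B) = θ A - θ B := fun A B => by
    simp only [← hθ, Matrix.transpose_sub, mul_sub, sub_mul]
  have hinv : ∀ A, θ (θ A) = A := fun A => by
    simp only [← hθ, twist_twist hdet hG]
  simp only [skewProj_apply, Ring.lie_def, hθ, mul_sub, sub_mul, hsub, hmul, hinv]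
  abel

/-- This is `QF₁ = -QF₂` in coordinates: `θ` carries the combination of the `E_mj` on the left to
that of the `E_ml` on the right, and `skewProj G` changes sign under `θ`. -/
theorem sum_inv_smul_lieF (hdet : IsUnit G.det) (hG : Gᵀ = ((ε : ℤ) : ℂ) • G) (j l : Fin N) :
    ∑ m, G⁻¹ l m • lieF G m j = -∑ m, G⁻¹ m j • lieF G m l := by
  have hu : ∀ x y, ∑ m, G⁻¹ x m * G m y = if x = y then 1 else 0 := fun x y => by
    rw [← Matrix.mul_apply, Matrix.nonsing_inv_mul G hdet, Matrix.one_apply]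
  simp only [← skewProj_single, ← map_smul, ← map_sum]
  rw [eq_neg_iff_add_eq_zero, ← neg_eq_iff_add_eq_zero, ← skewProj_twist hdet hG]
  congr 1
  ext a b
  have h : ∀ m, (G⁻¹ * (Matrix.single m j (1 : ℂ))ᵀ * G) a b = G⁻¹ a j * G m b := fun m => by
    simp [Matrix.mul_apply, Matrix.single_apply, ite_and]
  simp only [Matrix.transpose_sum, Matrix.transpose_smul, Matrix.mul_sum, Matrix.sum_mul,
    Matrix.mul_smul, Matrix.smul_mul, Matrix.sum_apply, Matrix.smul_apply, h, smul_eq_mul]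
  rw [Finset.sum_congr rfl fun m _ => mul_left_comm (G⁻¹ l m) (G⁻¹ a j) (G m b),
    ← Finset.mul_sum, hu]
  simp [Matrix.single_apply, ite_and]

/-- The counterpart for `F₁Q = -F₂Q`, by the same argument. -/
theorem sum_smul_lieF (hdet : IsUnit G.det) (hG : Gᵀ = ((ε : ℤ) : ℂ) • G) (i k : Fin N) :
    ∑ m, G m k • lieF G i m = -∑ m, G i m • lieF G k m := by
  have hu : ∀ x y, ∑ m, G⁻¹ x m * G m y = if x = y then 1 else 0 := fun x y => by
    rw [← Matrix.mul_apply, Matrix.nonsing_inv_mul G hdet, Matrix.one_apply]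
  simp only [← skewProj_single, ← map_smul, ← map_sum]
  rw [eq_neg_iff_add_eq_zero, ← neg_eq_iff_add_eq_zero, ← skewProj_twist hdet hG]
  congr 1
  ext a b
  have h : ∀ m, (G⁻¹ * (Matrix.single i m (1 : ℂ))ᵀ * G) a b = G⁻¹ a m * G i b := fun m => by
    simp [Matrix.mul_apply, Matrix.single_apply, ite_and]
  simp only [Matrix.transpose_sum, Matrix.transpose_smul, Matrix.mul_sum, Matrix.sum_mul,
    Matrix.mul_smul, Matrix.smul_mul, Matrix.sum_apply, Matrix.smul_apply, h, smul_eq_mul]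
  rw [Finset.sum_congr rfl fun m _ =>
      show G m k * (G⁻¹ a m * G i b) = G i b * (G⁻¹ a m * G m k) by ring,
    ← Finset.mul_sum, hu]
  simp [Matrix.single_apply, ite_and, eq_comm]

theorem lieF_bracket (hdet : IsUnit G.det) (hG : Gᵀ = ((ε : ℤ) : ℂ) • G) (i j k l : Fin N) :
    ⁅lieF G i j, lieF G k l⁆ = (if k = j then lieF G i l else 0) - (if i = l then lieF G k j else 0)
      - ∑ m, (G m k * G⁻¹ l j) • lieF G i m + ∑ m, (G i k * G⁻¹ l m) • lieF G m j := by
  have hs : ∀ x y z w, G x y * G⁻¹ z w = G y x * G⁻¹ w z := fun x y z w => by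
    rw [apply_symm hG x y, inv_apply_symm hdet hG z w]
    linear_combination (G y x * G⁻¹ w z) * sign_mul_self ε
  rw [← skewProj_single, ← skewProj_single, skewProj_bracket hdet hG]
  simp only [← skewProj_single, ← map_smul, ← map_sum]
  rw [show (if k = j then skewProj G (Matrix.single i l 1) else 0)
      = skewProj G (if k = j then Matrix.single i l 1 else 0) by split_ifs <;> simp,
    show (if i = l then skewProj G (Matrix.single k j 1) else 0)
      = skewProj G (if i = l then Matrix.single k j 1 else 0) by split_ifs <;> simp,
    ← map_sub, ← map_sub, ← map_add]
  congr 1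
  have h1 : Matrix.single i j (1 : ℂ) * (G⁻¹ * (Matrix.single k l 1)ᵀ * G)
      = ∑ m, (G m k * G⁻¹ l j) • Matrix.single i m (1 : ℂ) := by
    ext a b
    simp only [hs _ k l j]
    simp [Matrix.mul_apply, Matrix.sum_apply, Matrix.single_apply, ite_and, mul_comm]
  have h2 : (G⁻¹ * (Matrix.single k l 1)ᵀ * G) * Matrix.single i j (1 : ℂ)
      = ∑ m, (G i k * G⁻¹ l m) • Matrix.single m j (1 : ℂ) := by
    ext a b
    simp only [hs i k l _]
    simp [Matrix.mul_apply, Matrix.sum_apply, Matrix.single_apply, ite_and, mul_comm]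
  have h3 : ∀ x y z w : Fin N, Matrix.single x y (1 : ℂ) * Matrix.single z w 1
      = if z = y then Matrix.single x w 1 else 0 := fun x y z w => by
    split_ifs with h
    · subst h; simp
    · exact Matrix.single_mul_single_of_ne _ _ _ _ (Ne.symm h) _
  rw [skewProj_apply, mul_sub, sub_mul, h1, h2, h3, h3]
  abel

theorem matF_mul_sub_mul (hdet : IsUnit G.det) (hG : Gᵀ = ((ε : ℤ) : ℂ) • G) (i j k l : Fin N) :
    matF G i j * matF G k l - matF G k l * matF G i j =
      (if k = j then matF G i l else 0) - (if i = l then matF G k j else 0)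
      - ∑ m, (G m k * G⁻¹ l j) • matF G i m + ∑ m, (G i k * G⁻¹ l m) • matF G m j := by
  obtain ⟨f, hf⟩ : ∃ f : Fin N → Fin N → gN G, ∀ i j, f i j = ⟨lieF G i j, lieF_mem_gN G i j⟩ :=
    ⟨_, fun _ _ => rfl⟩
  have hF : ∀ i j, matF G i j = UniversalEnvelopingAlgebra.ι ℂ (f i j) := fun i j => by
    rw [hf]; rfl
  have h : ⁅f i j, f k l⁆ = (if k = j then f i l else 0) - (if i = l then f k j else 0)
      - ∑ m, (G m k * G⁻¹ l j) • f i m + ∑ m, (G i k * G⁻¹ l m) • f m j := by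
    apply Subtype.ext
    have := lieF_bracket hdet hG i j k l
    push_cast [LieSubalgebra.coe_bracket, apply_ite Subtype.val]
    simpa only [hf] using this
  have h' := congrArg (UniversalEnvelopingAlgebra.ι ℂ) h
  rw [LieHom.map_lie, Ring.lie_def] at h'
  simp only [hF, h', map_add, map_sub, map_sum, map_smul, apply_ite (UniversalEnvelopingAlgebra.ι ℂ),
    map_zero]

theorem sum_smul_matF_eq_neg {c d : Fin N → ℂ} {p q p' q' : Fin N → Fin N}
    (h : ∑ m, c m • lieF G (p m) (q m) = -∑ m, d m • lieF G (p' m) (q' m)) :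
    ∑ m, c m • matF G (p m) (q m) = -∑ m, d m • matF G (p' m) (q' m) := by
  obtain ⟨f, hf⟩ : ∃ f : Fin N → Fin N → gN G, ∀ i j, f i j = ⟨lieF G i j, lieF_mem_gN G i j⟩ :=
    ⟨_, fun _ _ => rfl⟩
  have hF : ∀ i j, matF G i j = UniversalEnvelopingAlgebra.ι ℂ (f i j) := fun i j => by
    rw [hf]; rfl
  have h' : ∑ m, c m • f (p m) (q m) = -∑ m, d m • f (p' m) (q' m) := by
    apply Subtype.ext
    push_cast
    simpa only [hf] using h
  simpa only [hF, map_sum, map_smul, map_neg] using congrArg (UniversalEnvelopingAlgebra.ι ℂ) h'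

/-- The defining relations `F₁ F₂ - F₂ F₁ = F₁ (P - Q) - (P - Q) F₁` in matrix form. -/
theorem matF_comm (hdet : IsUnit G.det) (hG : Gᵀ = ((ε : ℤ) : ℂ) • G) :
    (matF G ⊗ₖ (1 : Matrix (Fin N) (Fin N) (UgN G))) * (1 ⊗ₖ matF G)
        - (1 ⊗ₖ matF G) * (matF G ⊗ₖ 1) =
      (matF G ⊗ₖ 1) * (opP N).map (algebraMap ℂ (UgN G))
        - (opP N).map (algebraMap ℂ (UgN G)) * (matF G ⊗ₖ 1)
        - (matF G ⊗ₖ 1) * (opQ G).map (algebraMap ℂ (UgN G))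
        + (opQ G).map (algebraMap ℂ (UgN G)) * (matF G ⊗ₖ 1) := by
  ext ⟨i, k⟩ ⟨j, l⟩
  have h := matF_mul_sub_mul hdet hG i j k l
  simp only [Matrix.add_apply, Matrix.sub_apply, Matrix.mul_apply, Fintype.sum_prod_type,
    Matrix.map_apply, opP_apply, opQ_apply,
    Matrix.kroneckerMap_apply, Matrix.one_apply, ite_and]
  simp [apply_ite (algebraMap ℂ (UgN G)), Algebra.smul_def] at h ⊢
  have hc : ∀ x y z w, matF G z w * (algebraMap ℂ (UgN G) x * algebraMap ℂ (UgN G) y)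
      = algebraMap ℂ (UgN G) x * algebraMap ℂ (UgN G) y * matF G z w := fun x y z w => by
    rw [← map_mul, Algebra.commutes]
  simpa only [hc] using h

theorem opQ_mul_matF (hdet : IsUnit G.det) (hG : Gᵀ = ((ε : ℤ) : ℂ) • G) :
    (opQ G).map (algebraMap ℂ (UgN G)) * (matF G ⊗ₖ (1 : Matrix (Fin N) (Fin N) (UgN G)))
      = -((opQ G).map (algebraMap ℂ (UgN G)) * (1 ⊗ₖ matF G)) := by
  ext ⟨i, k⟩ ⟨j, l⟩
  have h := congrArg (G i k • ·) (sum_smul_matF_eq_neg (sum_inv_smul_lieF hdet hG j l))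
  simp only [Matrix.neg_apply, Matrix.mul_apply, Fintype.sum_prod_type,
    Matrix.map_apply, opQ_apply, Matrix.kroneckerMap_apply, Matrix.one_apply]
  simp [Algebra.smul_def] at h ⊢
  simpa only [Finset.mul_sum, mul_assoc] using h

theorem matF_mul_opQ (hdet : IsUnit G.det) (hG : Gᵀ = ((ε : ℤ) : ℂ) • G) :
    (matF G ⊗ₖ (1 : Matrix (Fin N) (Fin N) (UgN G))) * (opQ G).map (algebraMap ℂ (UgN G))
      = -((1 ⊗ₖ matF G) * (opQ G).map (algebraMap ℂ (UgN G))) := by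
  ext ⟨i, k⟩ ⟨j, l⟩
  have h := congrArg (G⁻¹ l j • ·) (sum_smul_matF_eq_neg (sum_smul_lieF hdet hG i k))
  simp only [Matrix.neg_apply, Matrix.mul_apply, Fintype.sum_prod_type,
    Matrix.map_apply, opQ_apply, Matrix.kroneckerMap_apply, Matrix.one_apply]
  simp [Algebra.smul_def] at h ⊢
  have hc : ∀ x y z w, matF G z w * (algebraMap ℂ (UgN G) x * algebraMap ℂ (UgN G) y)
      = algebraMap ℂ (UgN G) y * (algebraMap ℂ (UgN G) x * matF G z w) := fun x y z w => by
    rw [← map_mul, ← Algebra.commutes, mul_comm x y, map_mul, mul_assoc]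
  simpa only [Finset.mul_sum, hc] using h

theorem opP_mul_kronecker_one {A : Type*} [Ring A] [Algebra ℂ A] (M : Matrix (Fin N) (Fin N) A) :
    (opP N).map (algebraMap ℂ A) * (M ⊗ₖ (1 : Matrix (Fin N) (Fin N) A))
      = (1 ⊗ₖ M) * (opP N).map (algebraMap ℂ A) := by
  ext ⟨i, k⟩ ⟨j, l⟩
  simp only [Matrix.mul_apply, Fintype.sum_prod_type, Matrix.map_apply, opP_apply,
    Matrix.kroneckerMap_apply, Matrix.one_apply, ite_and]
  simp [apply_ite (algebraMap ℂ A)]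

end Commutation

/-! ### Iterated Laurent series -/

section LaurentLemmas

theorem commute_of_commute_coeff {A : Type*} [Ring A] {x y : A⸨X⸩}
    (h : ∀ i j, x.coeff i * y.coeff j = y.coeff j * x.coeff i) : x * y = y * x := by
  ext n
  rw [HahnSeries.coeff_mul, HahnSeries.coeff_mul]
  exact Finset.sum_equiv (Equiv.prodComm _ _)
    (fun _ => Finset.swap_mem_antidiagonal.symm) fun p _ => by simp [h]

theorem mapLaurent_coeff {A B : Type*} [Ring A] [Ring B] (f : A →+* B) (x : A⸨X⸩) (n : ℤ) :
    (mapLaurent f x).coeff n = f (x.coeff n) := rfl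

theorem mapLaurent_C {A B : Type*} [Ring A] [Ring B] (f : A →+* B) (a : A) :
    mapLaurent f (HahnSeries.C a) = HahnSeries.C (f a) :=
  HahnSeries.map_C a f

theorem mapLaurent_single {A B : Type*} [Ring A] [Ring B] (f : A →+* B) (n : ℤ) (a : A) :
    mapLaurent f (HahnSeries.single n a) = HahnSeries.single n (f a) :=
  HahnSeries.map_single f.toMonoidWithZeroHom.toZeroHom

theorem mapLaurent_ofPowerSeries {A B : Type*} [Ring A] [Ring B] (f : A →+* B) (p : A⟦X⟧) :
    mapLaurent f (HahnSeries.ofPowerSeries ℤ A p)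
      = HahnSeries.ofPowerSeries ℤ B (PowerSeries.map f p) := by
  ext n
  rw [mapLaurent_coeff, PowerSeries.coeff_coe, PowerSeries.coeff_coe]
  split_ifs <;> simp

theorem scalars₂_commute {A : Type*} [Ring A] [Algebra ℂ A] (z : Laurent₂ ℂ) (y : Laurent₂ A) :
    scalars₂ A z * y = y * scalars₂ A z :=
  commute_of_commute_coeff fun _ _ => commute_of_commute_coeff fun _ _ => Algebra.commutes _ _

theorem scalars₂_const₂ {A : Type*} [Ring A] [Algebra ℂ A] (z : ℂ) :
    scalars₂ A (const₂ z) = HahnSeries.C (HahnSeries.C (algebraMap ℂ A z)) := by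
  simp only [scalars₂, const₂, RingHom.comp_apply, mapLaurent_C]

theorem inU_C {A : Type*} [Ring A] (x : A) :
    inU A (PowerSeries.C x) = HahnSeries.C (HahnSeries.C x) := by
  simp [inU]

theorem inV_C {A : Type*} [Ring A] (x : A) :
    inV A (PowerSeries.C x) = HahnSeries.C (HahnSeries.C x) := by
  simp [inV]

theorem scalars₂_varU_mul_inU_X {A : Type*} [Ring A] [Algebra ℂ A] :
    scalars₂ A varU * inU A PowerSeries.X = 1 := by
  simp [inU, scalars₂, varU, mapLaurent_single]

theorem scalars₂_varV_mul_inV_X {A : Type*} [Ring A] [Algebra ℂ A] :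
    scalars₂ A varV * inV A PowerSeries.X = 1 := by
  simp [inV, scalars₂, varV, mapLaurent_single]

theorem add_smul_varV_ne_zero (x : LaurentSeries ℂ) {c : ℂ} (hc : c ≠ 0) :
    HahnSeries.C x + const₂ c * varV ≠ 0 := by
  intro h
  -- Exponents count powers of `v⁻¹`, so this is the coefficient of `v`. It equals `c`, as `x`
  -- involves only `u`.
  have h' := congrArg (fun z : Laurent₂ ℂ => (z.coeff (-1)).coeff 0) h
  simp [const₂, varV, HahnSeries.C_apply, HahnSeries.coeff_single_of_ne, hc] at h'

end LaurentLemmas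

/-! ### The two copies of a matrix -/

section Kronecker

variable {N : ℕ} {R : Type*} [Ring R]

/-- `M ↦ M₁ = M ⊗ 1`. -/
def inFirst (N : ℕ) (R : Type*) [Ring R] :
    Matrix (Fin N) (Fin N) R →+* Matrix (Fin N × Fin N) (Fin N × Fin N) R where
  toFun M := M ⊗ₖ 1
  map_one' := Matrix.one_kronecker_one
  map_zero' := Matrix.zero_kronecker _
  map_add' A B := Matrix.add_kronecker A B _
  -- The mixed-product rule for Kronecker products needs commuting entries; here the second factor
  -- is `1`, whose entries are central.
  map_mul' A B := by
    ext ⟨i, k⟩ ⟨j, l⟩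
    simp [Matrix.mul_apply, Fintype.sum_prod_type, Matrix.one_apply]

/-- `M ↦ M₂ = 1 ⊗ M`. -/
def inSecond (N : ℕ) (R : Type*) [Ring R] :
    Matrix (Fin N) (Fin N) R →+* Matrix (Fin N × Fin N) (Fin N × Fin N) R where
  toFun M := 1 ⊗ₖ M
  map_one' := Matrix.one_kronecker_one
  map_zero' := Matrix.kronecker_zero _
  map_add' A B := Matrix.kronecker_add _ A B
  map_mul' A B := by
    ext ⟨i, k⟩ ⟨j, l⟩
    simp [Matrix.mul_apply, Fintype.sum_prod_type, Matrix.one_apply]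

theorem inFirst_map {S : Type*} [Ring S] (f : R →+* S) (M : Matrix (Fin N) (Fin N) R) :
    (inFirst N R M).map f = inFirst N S (M.map f) := by
  ext ⟨i, k⟩ ⟨j, l⟩
  simp [inFirst, Matrix.one_apply, apply_ite f]

theorem inSecond_map {S : Type*} [Ring S] (f : R →+* S) (M : Matrix (Fin N) (Fin N) R) :
    (inSecond N R M).map f = inSecond N S (M.map f) := by
  ext ⟨i, k⟩ ⟨j, l⟩
  simp [inSecond, Matrix.one_apply, apply_ite f]

theorem inFirst_scalar (r : R) : inFirst N R (Matrix.scalar _ r) = Matrix.scalar _ r := by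
  ext ⟨i, k⟩ ⟨j, l⟩
  simp [inFirst, Matrix.one_apply, Matrix.diagonal_apply, ite_and]
  split_ifs <;> rfl

theorem inSecond_scalar (r : R) : inSecond N R (Matrix.scalar _ r) = Matrix.scalar _ r := by
  ext ⟨i, k⟩ ⟨j, l⟩
  simp [inSecond, Matrix.one_apply, Matrix.diagonal_apply, ite_and]
  split_ifs <;> rfl

end Kronecker

/-! ### Geometric series as resolvents -/

section Geometric

variable {N : ℕ} {A : Type*} [Ring A]

/-- The matrix `∑_{r ≥ 0} M^r u^{-r}`. -/
def geomMatrix (M : Matrix (Fin N) (Fin N) A) : Matrix (Fin N) (Fin N) A⟦X⟧ :=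
  Matrix.of fun i j => PowerSeries.mk fun r => (M ^ r) i j

theorem geomMatrix_eq_one_add (M : Matrix (Fin N) (Fin N) A) :
    geomMatrix M =
      1 + Matrix.scalar (Fin N) PowerSeries.X * (geomMatrix M * M.map PowerSeries.C) := by
  ext i j n
  rw [Matrix.scalar_apply, Matrix.add_apply, Matrix.diagonal_mul, map_add]
  cases n with
  | zero =>
    simp only [geomMatrix, Matrix.of_apply, PowerSeries.coeff_mk, pow_zero, Matrix.one_apply]
    split_ifs <;> simp
  | succ n =>
    simp [geomMatrix, Matrix.one_apply, PowerSeries.coeff_succ_X_mul, Matrix.mul_apply, pow_succ,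
      apply_ite, PowerSeries.coeff_one]

theorem geomMatrix_mul_comm (M : Matrix (Fin N) (Fin N) A) :
    geomMatrix M * M.map PowerSeries.C = M.map PowerSeries.C * geomMatrix M := by
  ext i j n
  have h := congrFun (congrFun ((pow_succ M n).symm.trans (pow_succ' M n)) i) j
  simpa [geomMatrix, Matrix.mul_apply] using h

/-- If `θ` sends `u⁻¹` to the central element `w⁻¹`, then `w⁻¹ ∑ M^r w^{-r}` is the inverse of
`w - M`. -/
theorem resolvent_of_geomMatrix {R : Type*} [Ring R] (θ : A⟦X⟧ →+* R) (w : R)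
    (hw : w * θ PowerSeries.X = 1) (hc : ∀ x, w * x = x * w)
    (M : Matrix (Fin N) (Fin N) A) :
    ∃ Z : Matrix (Fin N) (Fin N) R,
      Matrix.scalar _ w * Z = (geomMatrix M).map θ ∧
      Z * M.map (θ.comp PowerSeries.C) = Matrix.scalar _ w * Z - 1 ∧
      M.map (θ.comp PowerSeries.C) * Z = Matrix.scalar _ w * Z - 1 := by
  have hw' : θ PowerSeries.X * w = 1 := by rw [← hc, hw]
  -- The inverse of a central element is central.
  have hXc : ∀ x, θ PowerSeries.X * x = x * θ PowerSeries.X := fun x => by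
    calc θ PowerSeries.X * x = θ PowerSeries.X * (x * w) * θ PowerSeries.X := by
          rw [mul_assoc, mul_assoc, hw, mul_one]
      _ = x * θ PowerSeries.X := by rw [← hc, ← mul_assoc, hw', one_mul]
  have hs : Matrix.scalar (Fin N) w * Matrix.scalar (Fin N) (θ PowerSeries.X) = 1 := by
    rw [← map_mul, hw, map_one]
  have h1 := congrArg θ.mapMatrix (geomMatrix_eq_one_add M)
  have h2 := congrArg θ.mapMatrix (geomMatrix_mul_comm M)
  have hM : θ.mapMatrix (M.map PowerSeries.C) = M.map (θ.comp PowerSeries.C) := rfl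
  have hX : θ.mapMatrix (Matrix.scalar (Fin N) PowerSeries.X)
      = Matrix.scalar (Fin N) (θ PowerSeries.X) := by
    ext i j
    simp [Matrix.diagonal_apply, apply_ite θ]
  have hcm : ∀ L : Matrix (Fin N) (Fin N) R, Matrix.scalar (Fin N) (θ PowerSeries.X) * L
      = L * Matrix.scalar (Fin N) (θ PowerSeries.X) := fun L => by
    ext i j
    simp [hXc]
  rw [map_add, map_mul, map_mul, map_one, hM, hX] at h1
  rw [map_mul, map_mul, hM] at h2
  have hZ : Matrix.scalar (Fin N) w * (Matrix.scalar (Fin N) (θ PowerSeries.X)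
      * θ.mapMatrix (geomMatrix M)) = θ.mapMatrix (geomMatrix M) := by
    rw [← mul_assoc, hs, one_mul]
  have h3 : Matrix.scalar (Fin N) (θ PowerSeries.X) * θ.mapMatrix (geomMatrix M)
      * M.map (θ.comp PowerSeries.C) = θ.mapMatrix (geomMatrix M) - 1 := by
    rw [mul_assoc, eq_sub_iff_add_eq']; exact h1.symm
  refine ⟨Matrix.scalar _ (θ PowerSeries.X) * θ.mapMatrix (geomMatrix M), hZ, ?_, ?_⟩
  · rw [hZ, h3]
  · rw [hZ, ← h3, mul_assoc, h2, ← mul_assoc, ← mul_assoc, hcm]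

end Geometric

/-! ### The reflection equation and the unitary condition for the evaluation matrix -/

section ReflectionEquation

variable {N : ℕ} {G : Matrix (Fin N) (Fin N) ℂ} {ε : ℤˣ}

theorem evalSeries_eq : evalSeries G = geomMatrix (shiftF G) + geomMatrix (shiftF G) - 1 := by
  ext i j n
  rcases Nat.eq_zero_or_pos n with rfl | hn
  · simp only [evalSeries, genMatrix, geomMatrix, Matrix.of_apply, Matrix.sub_apply,
      Matrix.add_apply, map_sub, map_add, PowerSeries.coeff_mk, pow_zero, Matrix.one_apply,
      lt_irrefl, dif_neg, not_false_eq_true]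
    split_ifs <;> simp
  · simp only [evalSeries, genMatrix, geomMatrix, Matrix.of_apply, Matrix.sub_apply,
      Matrix.add_apply, map_sub, map_add, PowerSeries.coeff_mk, Matrix.one_apply, hn, dif_pos,
      PNat.mk_coe]
    split_ifs <;> simp [PowerSeries.coeff_one, hn.ne', two_mul]

theorem geomMatrix_map {A R : Type*} [Ring A] [Ring R] (M : Matrix (Fin N) (Fin N) A)
    (θ : A⟦X⟧ →+* R) :
    (geomMatrix M + geomMatrix M - 1).map θ = (geomMatrix M).map θ + (geomMatrix M).map θ - 1 :=
  (map_sub θ.mapMatrix _ _).trans (by rw [map_add, map_one]; rfl)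

/-- The operator `P` with entries in `A`. -/
def scalarP (N : ℕ) (A : Type*) [Ring A] [Algebra ℂ A] :
    Matrix (Fin N × Fin N) (Fin N × Fin N) A :=
  (opP N).map (algebraMap ℂ A)

/-- The operator `Q` with entries in `A`. -/
def scalarQ (G : Matrix (Fin N) (Fin N) ℂ) (A : Type*) [Ring A] [Algebra ℂ A] :
    Matrix (Fin N × Fin N) (Fin N × Fin N) A :=
  (opQ G).map (algebraMap ℂ A)

section

variable {A : Type*} [Ring A] [Algebra ℂ A]

theorem map_algebraMap_smul (z : ℂ) (m : Matrix (Fin N × Fin N) (Fin N × Fin N) ℂ) :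
    (z • m).map (algebraMap ℂ A) = z • m.map (algebraMap ℂ A) := by
  ext i j : 2
  rw [Matrix.map_apply, Matrix.smul_apply, Matrix.smul_apply, Matrix.map_apply, smul_eq_mul,
    map_mul, Algebra.smul_def]

theorem scalarP_mul_scalarP (N : ℕ) (A : Type*) [Ring A] [Algebra ℂ A] :
    scalarP N A * scalarP N A = 1 := by
  rw [scalarP, ← Matrix.map_mul, opP_mul_opP]
  exact map_one (algebraMap ℂ A).mapMatrix

theorem scalarP_mul_scalarQ (hG : Gᵀ = ((ε : ℤ) : ℂ) • G) :
    scalarP N A * scalarQ G A = ((ε : ℤ) : ℂ) • scalarQ G A := by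
  rw [scalarP, scalarQ, ← Matrix.map_mul, opP_mul_opQ hG, map_algebraMap_smul]

theorem scalarQ_mul_scalarP (hdet : IsUnit G.det) (hG : Gᵀ = ((ε : ℤ) : ℂ) • G) :
    scalarQ G A * scalarP N A = ((ε : ℤ) : ℂ) • scalarQ G A := by
  rw [scalarP, scalarQ, ← Matrix.map_mul, opQ_mul_opP hdet hG, map_algebraMap_smul]

theorem scalarQ_mul_scalarQ (hdet : IsUnit G.det) :
    scalarQ G A * scalarQ G A = (N : ℂ) • scalarQ G A := by
  rw [scalarQ, ← Matrix.map_mul, opQ_mul_opQ hdet, map_algebraMap_smul]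

theorem scalarP_mul_inFirst (M : Matrix (Fin N) (Fin N) A) :
    scalarP N A * inFirst N A M = inSecond N A M * scalarP N A :=
  opP_mul_kronecker_one M

end

theorem inFirst_shiftF :
    inFirst N _ (shiftF G) = inFirst N _ (matF G) - ((N : ℂ) / 4) • 1 := by
  rw [shiftF, map_sub, sub_right_inj]
  exact (Matrix.smul_kronecker _ _ _).trans (congrArg _ Matrix.one_kronecker_one)

theorem inSecond_shiftF :
    inSecond N _ (shiftF G) = inSecond N _ (matF G) - ((N : ℂ) / 4) • 1 := by
  rw [shiftF, map_sub, sub_right_inj]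
  exact (Matrix.kronecker_smul _ _ _).trans (congrArg _ Matrix.one_kronecker_one)

/-- Each of the two copies contributes a shift `N/4` to `QF₁ = -QF₂`. -/
theorem scalarQ_mul_shiftF (hdet : IsUnit G.det) (hG : Gᵀ = ((ε : ℤ) : ℂ) • G) :
    scalarQ G (UgN G) * inFirst N _ (shiftF G) =
      -(scalarQ G (UgN G) * inSecond N _ (shiftF G)) - ((N : ℂ) / 2) • scalarQ G (UgN G) := by
  have h : scalarQ G (UgN G) * inFirst N _ (matF G)
      = -(scalarQ G (UgN G) * inSecond N _ (matF G)) := opQ_mul_matF hdet hG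
  rw [inFirst_shiftF, inSecond_shiftF, mul_sub, mul_sub, h, Matrix.mul_smul, mul_one]
  module

theorem shiftF_mul_scalarQ (hdet : IsUnit G.det) (hG : Gᵀ = ((ε : ℤ) : ℂ) • G) :
    inFirst N _ (shiftF G) * scalarQ G (UgN G) =
      -(inSecond N _ (shiftF G) * scalarQ G (UgN G)) - ((N : ℂ) / 2) • scalarQ G (UgN G) := by
  have h : inFirst N _ (matF G) * scalarQ G (UgN G)
      = -(inSecond N _ (matF G) * scalarQ G (UgN G)) := matF_mul_opQ hdet hG
  rw [inFirst_shiftF, inSecond_shiftF, sub_mul, sub_mul, h, Matrix.smul_mul, one_mul]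
  module

theorem shiftF_comm (hdet : IsUnit G.det) (hG : Gᵀ = ((ε : ℤ) : ℂ) • G) :
    inFirst N _ (shiftF G) * inSecond N _ (shiftF G)
        - inSecond N _ (shiftF G) * inFirst N _ (shiftF G) =
      inFirst N _ (shiftF G) * scalarP N (UgN G) - scalarP N (UgN G) * inFirst N _ (shiftF G)
        - inFirst N _ (shiftF G) * scalarQ G (UgN G)
        + scalarQ G (UgN G) * inFirst N _ (shiftF G) := by
  have h : inFirst N _ (matF G) * inSecond N _ (matF G)
        - inSecond N _ (matF G) * inFirst N _ (matF G) =
      inFirst N _ (matF G) * scalarP N (UgN G) - scalarP N (UgN G) * inFirst N _ (matF G)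
        - inFirst N _ (matF G) * scalarQ G (UgN G)
        + scalarQ G (UgN G) * inFirst N _ (matF G) := matF_comm hdet hG
  rw [inFirst_shiftF, inSecond_shiftF]
  simp only [mul_sub, sub_mul, Matrix.mul_smul, Matrix.smul_mul, mul_one, one_mul]
  linear_combination (norm := module) h

theorem opR_map {A : Type*} [Ring A] [Algebra ℂ A] (z : Laurent₂ ℂ) :
    (opR G ε z).map (scalars₂ A) =
      1 - Matrix.scalar _ (scalars₂ A z⁻¹) *
          (HahnSeries.C.comp HahnSeries.C : A →+* Laurent₂ A).mapMatrix (scalarP N A)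
        + Matrix.scalar _ (scalars₂ A (z - const₂ (kappa N ε))⁻¹) *
          (HahnSeries.C.comp HahnSeries.C : A →+* Laurent₂ A).mapMatrix (scalarQ G A) := by
  ext i j : 2
  simp only [opR, Matrix.map_apply, Matrix.add_apply, Matrix.sub_apply, Matrix.smul_apply,
    smul_eq_mul, map_add, map_sub, map_mul, Matrix.scalar_apply, Matrix.diagonal_mul,
    scalars₂_const₂, RingHom.comp_apply, RingHom.mapMatrix_apply, scalarP, scalarQ]
  congr 2
  rw [Matrix.one_apply, Matrix.one_apply, apply_ite (scalars₂ A), map_one, map_zero]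

theorem varU_sub_varV_sub_ne_zero (k : ℂ) : varU - varV - const₂ k ≠ 0 := by
  have h := add_smul_varV_ne_zero (HahnSeries.single (-1) 1 - HahnSeries.C k)
    (neg_ne_zero.2 (one_ne_zero (α := ℂ)))
  convert h using 1
  simp only [varU, map_sub, map_neg, map_one, const₂, RingHom.comp_apply]
  ring

theorem varU_add_varV_sub_ne_zero (k : ℂ) : varU + varV - const₂ k ≠ 0 := by
  have h := add_smul_varV_ne_zero (HahnSeries.single (-1) 1 - HahnSeries.C k)
    (one_ne_zero (α := ℂ))
  convert h using 1
  simp only [varU, map_sub, map_one, const₂, RingHom.comp_apply]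
  ring

theorem varU_sub_varV_ne_zero : varU - varV ≠ 0 := by
  simpa only [map_zero, sub_zero] using varU_sub_varV_sub_ne_zero 0

theorem varU_add_varV_ne_zero : varU + varV ≠ 0 := by
  simpa only [map_zero, sub_zero] using varU_add_varV_sub_ne_zero 0

/-- A matrix `M` whose two copies satisfy the commutation relations of `F - N/4` gives a solution
`2 ∑_{r ≥ 0} M^r u^{-r} - 1` of the reflection equation. -/
theorem reflection_geomMatrix {A : Type*} [Ring A] [Algebra ℂ A] (M : Matrix (Fin N) (Fin N) A)
    (hdet : IsUnit G.det) (hG : Gᵀ = ((ε : ℤ) : ℂ) • G)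
    (hQF : scalarQ G A * inFirst N _ M =
      -(scalarQ G A * inSecond N _ M) - ((N : ℂ) / 2) • scalarQ G A)
    (hFQ : inFirst N _ M * scalarQ G A =
      -(inSecond N _ M * scalarQ G A) - ((N : ℂ) / 2) • scalarQ G A)
    (hFF : inFirst N _ M * inSecond N _ M - inSecond N _ M * inFirst N _ M =
      inFirst N _ M * scalarP N A - scalarP N A * inFirst N _ M
        - inFirst N _ M * scalarQ G A + scalarQ G A * inFirst N _ M) :
    reflLHS G ε (geomMatrix M + geomMatrix M - 1)
      = reflRHS G ε (geomMatrix M + geomMatrix M - 1) := by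
  obtain ⟨Z, hZ, hZ1, hZ2⟩ := resolvent_of_geomMatrix (inU A) (scalars₂ _ varU)
    scalars₂_varU_mul_inU_X (scalars₂_commute _) M
  obtain ⟨W, hW, hW1, hW2⟩ := resolvent_of_geomMatrix (inV A) (scalars₂ _ varV)
    scalars₂_varV_mul_inV_X (scalars₂_commute _) M
  obtain ⟨c, hc⟩ : ∃ c : A →+* Laurent₂ A, c = HahnSeries.C.comp HahnSeries.C := ⟨_, rfl⟩
  have hcU : (inU A).comp PowerSeries.C = c := by
    rw [hc]; exact RingHom.ext inU_C
  have hcV : (inV A).comp PowerSeries.C = c := by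
    rw [hc]; exact RingHom.ext inV_C
  rw [hcU] at hZ1 hZ2
  rw [hcV] at hW1 hW2
  -- The field `ℂ((u⁻¹))((v⁻¹))` acts on the matrices over `A((u⁻¹))((v⁻¹))` by central scalar
  -- matrices; `f` is this action.
  obtain ⟨f, hf⟩ : ∃ f : Laurent₂ ℂ →+* Matrix (Fin N × Fin N) (Fin N × Fin N) (Laurent₂ A),
      ∀ z, f z = Matrix.scalar _ (scalars₂ _ z) :=
    ⟨(Matrix.scalar _).comp (scalars₂ _), fun _ => rfl⟩
  have hfc : ∀ k m, f k * m = m * f k := fun k m => by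
    ext i j : 2
    simp [hf, scalars₂_commute]
  have hconst : ∀ (z : ℂ) (m : Matrix (Fin N × Fin N) (Fin N × Fin N) A),
      c.mapMatrix (z • m) = f (const₂ z) * c.mapMatrix m := fun z m => by
    ext i j : 2
    rw [hf, Matrix.scalar_apply, Matrix.diagonal_mul, scalars₂_const₂, hc, RingHom.mapMatrix_apply,
      RingHom.mapMatrix_apply, Matrix.map_apply, Matrix.map_apply, Matrix.smul_apply,
      Algebra.smul_def, map_mul]
    rfl
  have hPP := scalarP_mul_scalarP N A
  have hPQ := scalarP_mul_scalarQ (A := A) hG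
  have hQP := scalarQ_mul_scalarP (A := A) hdet hG
  have hQQ := scalarQ_mul_scalarQ (A := A) hdet
  have hPF := scalarP_mul_inFirst M
  have hPdef := opR_map (G := G) (ε := ε) (A := A)
  rw [← hc] at hPdef
  generalize scalarP N A = P at *
  generalize scalarQ G A = Q at *
  obtain ⟨F₁, hF₁⟩ : ∃ F₁, F₁ = inFirst N _ M := ⟨_, rfl⟩
  obtain ⟨F₂, hF₂⟩ : ∃ F₂, F₂ = inSecond N _ M := ⟨_, rfl⟩
  rw [← hF₁, ← hF₂] at hPF hQF hFQ hFF
  have hF₁c : c.mapMatrix F₁ = inFirst N _ (M.map c) := by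
    rw [hF₁]; exact inFirst_map c _
  have hF₂c : c.mapMatrix F₂ = inSecond N _ (M.map c) := by
    rw [hF₂]; exact inSecond_map c _
  have hu : f varU = inFirst N _ (Matrix.scalar _ (scalars₂ _ varU)) := by
    rw [hf, inFirst_scalar]
  have hv : f varV = inSecond N _ (Matrix.scalar _ (scalars₂ _ varV)) := by
    rw [hf, inSecond_scalar]
  have hn : const₂ (N : ℂ) = 2 * const₂ (kappa N ε) + 2 * const₂ ((ε : ℤ) : ℂ) := by
    rw [← map_ofNat const₂ 2, ← map_mul, ← map_mul, ← map_add, kappa]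
    congr 1; ring
  have hn2 : const₂ ((N : ℂ) / 2) = const₂ (N : ℂ) / 2 := by rw [map_div₀, map_ofNat]
  replace hPP : c.mapMatrix P * c.mapMatrix P = 1 := by rw [← map_mul, hPP, map_one]
  replace hPQ := congrArg c.mapMatrix hPQ
  replace hQP := congrArg c.mapMatrix hQP
  replace hQQ := congrArg c.mapMatrix hQQ
  replace hPF := congrArg c.mapMatrix hPF
  replace hQF := congrArg c.mapMatrix hQF
  replace hFQ := congrArg c.mapMatrix hFQ
  replace hFF := congrArg c.mapMatrix hFF
  rw [map_mul, hconst] at hPQ hQP hQQ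
  rw [map_mul, map_mul] at hPF
  rw [map_mul, map_sub, map_neg, map_mul, hconst, hn2] at hQF hFQ
  simp only [map_sub, map_add, map_mul] at hFF
  replace hZ1 := congrArg (inFirst N _) hZ1
  replace hZ2 := congrArg (inFirst N _) hZ2
  replace hW1 := congrArg (inSecond N _) hW1
  replace hW2 := congrArg (inSecond N _) hW2
  rw [map_mul, map_sub, map_mul, map_one, ← hu, ← hF₁c] at hZ1 hZ2
  rw [map_mul, map_sub, map_mul, map_one, ← hv, ← hF₂c] at hW1 hW2
  have h2 : (2 : Laurent₂ ℂ) ≠ 0 := by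
    rw [← map_ofNat const₂ 2]
    exact (map_ne_zero const₂).2 two_ne_zero
  have key := reflection_of_central (K := Laurent₂ ℂ)
    (M := Matrix (Fin N × Fin N) (Fin N × Fin N) (Laurent₂ A)) f
    (map_one f) (map_add f) (map_mul f) hfc hn
    varU_sub_varV_ne_zero varU_add_varV_ne_zero
    (varU_sub_varV_sub_ne_zero _) (varU_add_varV_sub_ne_zero _) hPP hPQ hQP hQQ hPF hQF hFQ hFF
    hZ1 hZ2 hW1 hW2 h2
  have hSU : (geomMatrix M + geomMatrix M - 1).map (inU A) ⊗ₖ 1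
      = f (2 * varU) * inFirst N _ Z - 1 := by
    rw [geomMatrix_map, ← hZ, two_mul, map_add, hu, add_mul, ← map_mul, ← map_add,
      ← map_one (inFirst N _), ← map_sub]
    rfl
  have hSV : 1 ⊗ₖ (geomMatrix M + geomMatrix M - 1).map (inV A)
      = f (2 * varV) * inSecond N _ W - 1 := by
    rw [geomMatrix_map, ← hW, two_mul, map_add, hv, add_mul, ← map_mul, ← map_add,
      ← map_one (inSecond N _), ← map_sub]
    rfl
  simp only [← hf] at hPdef
  rw [reflLHS, reflRHS, hPdef, hPdef, hSU, hSV]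
  exact key

theorem reflection_evalSeries (hdet : IsUnit G.det) (hG : Gᵀ = ((ε : ℤ) : ℂ) • G) :
    reflLHS G ε (evalSeries G) = reflRHS G ε (evalSeries G) := by
  rw [evalSeries_eq]
  exact reflection_geomMatrix _ hdet hG (scalarQ_mul_shiftF hdet hG) (shiftF_mul_scalarQ hdet hG)
    (shiftF_comm hdet hG)

theorem negArg_geomMatrix {A : Type*} [Ring A] (M : Matrix (Fin N) (Fin N) A) :
    (geomMatrix M + geomMatrix M - 1).map negArg = geomMatrix (-M) + geomMatrix (-M) - 1 := by
  ext i j n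
  have h : ((-M) ^ n) i j = (-1) ^ n * (M ^ n) i j := by
    rcases Nat.even_or_odd n with hn | hn <;> simp [hn.neg_pow]
  have h1 : (-1) ^ n * PowerSeries.coeff n ((1 : Matrix (Fin N) (Fin N) A⟦X⟧) i j)
      = PowerSeries.coeff n ((1 : Matrix (Fin N) (Fin N) A⟦X⟧) i j) := by
    rw [Matrix.one_apply]
    rcases Nat.eq_zero_or_pos n with rfl | hn
    · simp
    · split_ifs <;> simp [PowerSeries.coeff_one, hn.ne']
  simp only [negArg, geomMatrix, Matrix.map_apply, Matrix.of_apply, Matrix.sub_apply,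
    Matrix.add_apply, map_sub, map_add, PowerSeries.coeff_mk, mul_sub, mul_add, h, h1]

/-- With `y = u⁻¹M`, the series `g` and `h` are the inverses of `1 - y` and `1 + y`. Computing `gyh`
in two ways gives `2gh = g + h`, which is equivalent to `(2g - 1)(2h - 1) = 1`. -/
theorem unitary_evalSeries : evalSeries G * (evalSeries G).map negArg = 1 := by
  rw [evalSeries_eq, negArg_geomMatrix]
  obtain ⟨g, hg⟩ : ∃ g, g = geomMatrix (shiftF G) := ⟨_, rfl⟩
  obtain ⟨h, hh⟩ : ∃ h, h = geomMatrix (-shiftF G) := ⟨_, rfl⟩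
  obtain ⟨y, hy⟩ : ∃ y, y = Matrix.scalar (Fin N) (PowerSeries.X : (UgN G)⟦X⟧)
    * (shiftF G).map PowerSeries.C := ⟨_, rfl⟩
  have hcm : ∀ L : Matrix (Fin N) (Fin N) (UgN G)⟦X⟧, Matrix.scalar (Fin N) PowerSeries.X * L
      = L * Matrix.scalar (Fin N) PowerSeries.X := fun L => by
    ext i j : 2
    simp [(PowerSeries.commute_X _).eq]
  have h1 : g * y = g - 1 := by
    have := geomMatrix_eq_one_add (shiftF G)
    rw [← mul_assoc, hcm, mul_assoc, ← hy, ← hg] at this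
    rw [eq_sub_iff_add_eq']; exact this.symm
  have h2 : y * h = 1 - h := by
    have := geomMatrix_eq_one_add (-shiftF G)
    rw [geomMatrix_mul_comm, ← mul_assoc, ← hh] at this
    have hm : (-shiftF G).map (PowerSeries.C : UgN G →+* _) = -(shiftF G).map PowerSeries.C :=
      map_neg (PowerSeries.C : UgN G →+* _).mapMatrix _
    rw [hm, mul_neg, ← hy, neg_mul] at this
    nth_rw 2 [this]; abel
  have h3 : g * h - h = g - g * h := by
    calc g * h - h = g * y * h := by rw [h1, sub_mul, one_mul]
      _ = g - g * h := by rw [mul_assoc, h2, mul_sub, mul_one]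
  rw [← hg, ← hh]
  calc (g + g - 1) * (h + h - 1)
      = 1 + ((g * h - h) - (g - g * h)) + ((g * h - h) - (g - g * h)) := by noncomm_ring
    _ = 1 := by rw [h3]; simp

end ReflectionEquation

/-! ### Naturality of the relations in the coefficient algebra -/

section Naturality

variable {N : ℕ} {A B : Type*} [Ring A] [Ring B]

theorem genMatrix_map (ψ : A →+* B) (s : Fin N → Fin N → ℕ+ → A) :
    (genMatrix s).map (PowerSeries.map ψ) = genMatrix fun i j r => ψ (s i j r) := by
  ext i j n
  simp only [genMatrix, Matrix.map_apply, Matrix.of_apply, PowerSeries.coeff_map,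
    PowerSeries.coeff_mk]
  split_ifs <;> simp

theorem map_negArg (ψ : A →+* B) (p : A⟦X⟧) :
    PowerSeries.map ψ (negArg p) = negArg (PowerSeries.map ψ p) := by
  ext n
  simp [negArg]

variable [Algebra ℂ A] [Algebra ℂ B]

/-- The map `A((u⁻¹))((v⁻¹)) → B((u⁻¹))((v⁻¹))` induced on coefficients. -/
def mapLaurent₂ (ψ : A →ₐ[ℂ] B) : Laurent₂ A →+* Laurent₂ B :=
  mapLaurent (mapLaurent (ψ : A →+* B))

theorem mapLaurent₂_scalars₂ (ψ : A →ₐ[ℂ] B) (z : Laurent₂ ℂ) :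
    mapLaurent₂ ψ (scalars₂ A z) = scalars₂ B z := by
  ext m n
  simp [mapLaurent₂, scalars₂, mapLaurent_coeff]

theorem mapLaurent₂_inU (ψ : A →ₐ[ℂ] B) (p : A⟦X⟧) :
    mapLaurent₂ ψ (inU A p) = inU B (PowerSeries.map (ψ : A →+* B) p) := by
  simp only [mapLaurent₂, inU, RingHom.comp_apply, mapLaurent_C, mapLaurent_ofPowerSeries]

theorem mapLaurent₂_inV (ψ : A →ₐ[ℂ] B) (p : A⟦X⟧) :
    mapLaurent₂ ψ (inV A p) = inV B (PowerSeries.map (ψ : A →+* B) p) := by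
  simp only [mapLaurent₂, inV, RingHom.comp_apply, mapLaurent_ofPowerSeries]
  congr 1
  ext n : 1
  simp only [PowerSeries.coeff_map, mapLaurent_C]

theorem map_scalars₂ (ψ : A →ₐ[ℂ] B) {n : Type*} (M : Matrix n n (Laurent₂ ℂ)) :
    (M.map (scalars₂ A)).map (mapLaurent₂ ψ) = M.map (scalars₂ B) := by
  ext i j : 2
  simp only [Matrix.map_apply, mapLaurent₂_scalars₂]

theorem map_kronecker_inU (ψ : A →ₐ[ℂ] B) (S : Matrix (Fin N) (Fin N) A⟦X⟧) :
    (S.map (inU A) ⊗ₖ (1 : Matrix (Fin N) (Fin N) (Laurent₂ A))).map (mapLaurent₂ ψ)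
      = (S.map (PowerSeries.map (ψ : A →+* B))).map (inU B) ⊗ₖ 1 := by
  refine (inFirst_map (mapLaurent₂ ψ) _).trans (congrArg (inFirst N _) ?_)
  ext i j : 2
  simp only [Matrix.map_apply, mapLaurent₂_inU]

theorem map_kronecker_inV (ψ : A →ₐ[ℂ] B) (S : Matrix (Fin N) (Fin N) A⟦X⟧) :
    ((1 : Matrix (Fin N) (Fin N) (Laurent₂ A)) ⊗ₖ S.map (inV A)).map (mapLaurent₂ ψ)
      = 1 ⊗ₖ (S.map (PowerSeries.map (ψ : A →+* B))).map (inV B) := by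
  refine (inSecond_map (mapLaurent₂ ψ) _).trans (congrArg (inSecond N _) ?_)
  ext i j : 2
  simp only [Matrix.map_apply, mapLaurent₂_inV]

variable (G : Matrix (Fin N) (Fin N) ℂ) (ε : ℤˣ)

theorem reflLHS_map (ψ : A →ₐ[ℂ] B) (S : Matrix (Fin N) (Fin N) A⟦X⟧) :
    (reflLHS G ε S).map (mapLaurent₂ ψ) = reflLHS G ε (S.map (PowerSeries.map (ψ : A →+* B))) := by
  simp only [reflLHS, Matrix.map_mul, map_scalars₂, map_kronecker_inU, map_kronecker_inV]

theorem reflRHS_map (ψ : A →ₐ[ℂ] B) (S : Matrix (Fin N) (Fin N) A⟦X⟧) :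
    (reflRHS G ε S).map (mapLaurent₂ ψ) = reflRHS G ε (S.map (PowerSeries.map (ψ : A →+* B))) := by
  simp only [reflRHS, Matrix.map_mul, map_scalars₂, map_kronecker_inU, map_kronecker_inV]

end Naturality

/-! ### Homomorphisms out of the reflection algebra -/

section Homomorphism

variable {N : ℕ} {G : Matrix (Fin N) (Fin N) ℂ} {ε : ℤˣ}

/-- A matrix over `A[[u⁻¹]]` which satisfies the defining relations of `B(𝔤_N)` is the image of
`S(u)` under a homomorphism. -/
theorem exists_algHom_of_relations {A : Type*} [Ring A] [Algebra ℂ A]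
    (s : Fin N → Fin N → ℕ+ → A) (hr : reflLHS G ε (genMatrix s) = reflRHS G ε (genMatrix s))
    (hu : genMatrix s * (genMatrix s).map negArg = 1) :
    ∃ φ : B G ε →ₐ[ℂ] A, ∀ i j r, φ (genB G ε i j r) = s i j r := by
  obtain ⟨ψ, hψ⟩ : ∃ ψ : FreeB N →ₐ[ℂ] A, ∀ i j r, ψ (FreeAlgebra.ι ℂ (i, j, r)) = s i j r :=
    ⟨FreeAlgebra.lift ℂ fun p => s p.1 p.2.1 p.2.2, fun i j r => by simp⟩
  have hS : (freeS N).map (PowerSeries.map (ψ : FreeB N →+* A)) = genMatrix s := by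
    rw [freeS, genMatrix_map]
    simp [hψ]
  have hrel : ∀ ⦃x y⦄, Rel G ε x y → ψ x = ψ y := by
    rintro _ _ (⟨p, q, m, n⟩ | ⟨i, j, n⟩)
    · have h : (reflLHS G ε (freeS N)).map (mapLaurent₂ ψ)
          = (reflRHS G ε (freeS N)).map (mapLaurent₂ ψ) := by
        rw [reflLHS_map, reflRHS_map, hS, hr]
      exact congrArg (fun M : Matrix _ _ (Laurent₂ A) => ((M p q).coeff m).coeff n) h
    · have h : (freeS N * (freeS N).map negArg).map (PowerSeries.map (ψ : FreeB N →+* A))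
          = (1 : Matrix (Fin N) (Fin N) (FreeB N)⟦X⟧).map
              (PowerSeries.map (ψ : FreeB N →+* A)) := by
        have h' : ((freeS N).map negArg).map (PowerSeries.map (ψ : FreeB N →+* A))
            = (genMatrix s).map negArg := by
          rw [← hS]
          ext i j : 2
          simp only [Matrix.map_apply, map_negArg]
        rw [Matrix.map_mul, h', hS, hu]
        exact (map_one (PowerSeries.map (ψ : FreeB N →+* A)).mapMatrix).symm
      have := congrArg (fun M : Matrix (Fin N) (Fin N) A⟦X⟧ => PowerSeries.coeff n (M i j)) h
      simp only [Matrix.map_apply, PowerSeries.coeff_map] at this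
      exact this
  refine ⟨RingQuot.liftAlgHom ℂ ⟨ψ, hrel⟩, fun i j r => ?_⟩
  rw [genB, RingQuot.liftAlgHom_mkAlgHom_apply, hψ]

theorem algHom_ext_genB {A : Type*} [Ring A] [Algebra ℂ A] {φ φ' : B G ε →ₐ[ℂ] A}
    (h : ∀ i j r, φ (genB G ε i j r) = φ' (genB G ε i j r)) : φ = φ' := by
  apply RingQuot.ringQuot_ext'
  apply FreeAlgebra.hom_ext
  funext ⟨i, j, r⟩
  exact h i j r

theorem genMatrix_injective {A : Type*} [Ring A] :
    Function.Injective (genMatrix : (Fin N → Fin N → ℕ+ → A) → _) := by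
  intro s t h
  funext i j r
  have := congrArg (fun M : Matrix (Fin N) (Fin N) A⟦X⟧ => PowerSeries.coeff (r : ℕ) (M i j)) h
  simp only [genMatrix, Matrix.of_apply, PowerSeries.coeff_mk, r.pos, dif_pos] at this
  exact this

end Homomorphism

/-! ### The quotient as a power series, and the conclusion -/

section Main

variable {N : ℕ} {G : Matrix (Fin N) (Fin N) ℂ}

theorem single_one_mul_comm {A : Type*} [Ring A] {n : ℤ} (x : A⸨X⸩) :
    HahnSeries.single n 1 * x = x * HahnSeries.single n 1 :=
  commute_of_commute_coeff fun i j => by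
    rw [HahnSeries.coeff_single]
    split_ifs <;> simp

/-- The matrix `Z = u⁻¹ ∑ M^r u^{-r}` is a two-sided inverse of `u - M`. From `MZ = uZ - 1` it
follows that `(u + M)Z = 2uZ - 1`, which is the required series. -/
theorem isUnit_evalDen_and_eval_eq : IsUnit (evalDen G) ∧
    evalNum G * Ring.inverse (evalDen G) =
      (evalSeries G).map (HahnSeries.ofPowerSeries ℤ (UgN G)) := by
  obtain ⟨Z, hZ, hZ1, hZ2⟩ := resolvent_of_geomMatrix (HahnSeries.ofPowerSeries ℤ (UgN G))
    (HahnSeries.single (-1) 1) (by simp) single_one_mul_comm (shiftF G)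
  have hC : (HahnSeries.ofPowerSeries ℤ (UgN G)).comp PowerSeries.C = HahnSeries.C :=
    RingHom.ext HahnSeries.ofPowerSeries_C
  rw [hC] at hZ1 hZ2
  have hcm : Matrix.scalar (Fin N) (HahnSeries.single (-1 : ℤ) (1 : UgN G)) * Z
      = Z * Matrix.scalar (Fin N) (HahnSeries.single (-1 : ℤ) (1 : UgN G)) := by
    ext i j : 1
    rw [Matrix.scalar_apply, Matrix.diagonal_mul, Matrix.mul_diagonal, single_one_mul_comm]
  have h1 : evalDen G * Z = 1 := by rw [evalDen, sub_mul, hZ2, sub_sub_cancel]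
  have h2 : Z * evalDen G = 1 := by rw [evalDen, mul_sub, hZ1, ← hcm, sub_sub_cancel]
  -- `Ring.inverse` vanishes on non-units, so a genuine unit is needed to identify it with `Z`.
  let U : (Matrix (Fin N) (Fin N) (UgN G)⸨X⸩)ˣ := ⟨evalDen G, Z, h1, h2⟩
  have hinv : Ring.inverse (evalDen G) = Z := Ring.inverse_unit U
  refine ⟨U.isUnit, ?_⟩
  rw [hinv, evalNum, add_mul, hZ2, evalSeries_eq, geomMatrix_map, ← hZ, add_sub_assoc]

end Main

end ReflectionAlgebra

end

theorem theorem3p3 (N : ℕ) (G : Matrix (Fin N) (Fin N) ℂ) (hdet : IsUnit G.det)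
    (ε : ℤˣ) (hG : G.transpose = ((ε : ℤ) : ℂ) • G) :
    IsUnit (ReflectionAlgebra.evalDen G) ∧
    ReflectionAlgebra.evalNum G * Ring.inverse (ReflectionAlgebra.evalDen G) =
      (ReflectionAlgebra.evalSeries G).map
        (HahnSeries.ofPowerSeries ℤ (ReflectionAlgebra.UgN G)) ∧
    ∃! φ : ReflectionAlgebra.B G ε →ₐ[ℂ] ReflectionAlgebra.UgN G,
      ((ReflectionAlgebra.matS G ε).map (PowerSeries.map (φ : _ →+* _))).map
          (HahnSeries.ofPowerSeries ℤ (ReflectionAlgebra.UgN G)) =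
        ReflectionAlgebra.evalNum G * Ring.inverse (ReflectionAlgebra.evalDen G) := by
  open ReflectionAlgebra in
  obtain ⟨hunit, heq⟩ := isUnit_evalDen_and_eval_eq (G := G)
  refine ⟨hunit, heq, ?_⟩
  obtain ⟨φ, hφ⟩ := exists_algHom_of_relations (G := G) (ε := ε)
    (fun i j r => 2 * (shiftF G ^ (r : ℕ)) i j)
    (reflection_evalSeries hdet hG) unitary_evalSeries
  rw [heq]
  refine ⟨φ, ?_, fun φ' hφ' => algHom_ext_genB fun i j r => ?_⟩
  · congr 1
    rw [matS, genMatrix_map, evalSeries]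
    exact congrArg genMatrix (funext fun i => funext fun j => funext fun r => hφ i j r)
  -- Power series embed into Laurent series, so comparing coefficients determines `φ'` on the
  -- generators.
  · have h := Matrix.map_injective HahnSeries.ofPowerSeries_injective hφ'
    rw [matS, genMatrix_map, evalSeries] at h
    exact (congrFun (congrFun (congrFun (genMatrix_injective h) i) j) r).trans (hφ i j r).symm
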